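/- For a nonnegative matrix $A\in\mathbb{R}_+^{n\times n}$, a distinguished eigenvalue is a real $\lambda\ge 0$ with $Av=\lambda v$ for some nonzero nonnegative vector $v$; the Perron root of $A$ is its largest distinguished eigenvalue. The digraph of $A$ has nodes $1,\dots,n$ and an edge $(i,j)$ whenever $a_{ij}>0$; the classes of $A$ are its strongly connected components (a single node counts as a component even without a loop). The reduced digraph of $A$ has the classes as nodes and an edge $(\mu,\nu)$ whenever $a_{ij}>0$ for some $i\in\mu$, $j\in\nu$. Write $\mu\to\nu$ if $\mu=\nu$ or there is a path from $\mu$ to $\nu$ in the reduced digraph; its transitive closure is the digraph on the classes with an edge $(\mu,\nu)$ if and only if $\mu\to\nu$. The Perron root $\alpha_\mu$ of a class $\mu$ is the Perron root of the principal submatrix of $A$ with index set $\mu$. A class $\nu$ is spectral if no other class has access to it, or if $\alpha_\nu>0$ and $\mu\to\nu$ implies $\alpha_\mu\le\alpha_\nu$; a spectral class $\nu$ is premier spectral if $\mu\to\nu$ and $\mu\ne\nu$ imply $\alpha_\mu<\alpha_\nu$. Theorem. Let $r\ge 1$, suppose that $A_1,\dots,A_r\in\mathbb{R}_+^{n\times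 n}$ pairwise commute and that, for each $i\in\{1,\dots,r\}$, distinct classes of $A_i$ have distinct Perron roots. Then: (i) All classes of $A_1,\dots,A_r$ and $A_1+\cdots+A_r$ coincide. (ii) The transitive closures of the reduced digraphs of $A_1,\dots,A_r$ and $A_1+\cdots+A_r$ coincide. (iii) $A_1,\dots,A_r$ have the same premier spectral classes, and these are premier spectral classes of $A_1+\cdots+A_r$. In particular, $A_1,\dots,A_r$ have the same (finite) number of distinct distinguished eigenvalues. (iv) Let $\mu_1,\dots,\mu_m$ be the common premier spectral classes of $A_1,\dots,A_r$ and let $\alpha_i^j$ be the Perron root of the class $\mu_j$ of $A_i$. Then, for every real polynomial $p(x_1,\dots,x_r)$ such that the matrix $p(A_1,\dots,A_r)$ is nonnegative, the distinguished eigenvalues of $p(A_1,\dots,A_r)$ are precisely the numbers $p(\alpha_1^j,\dots,\alpha_r^j)$, $j=1,\dots,m$ (possibly with repetitions). -/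

import Mathlib

noncomputable section

namespace NonnegMatrix

/-- A distinguished eigenvalue of `A`: a real `t ≥ 0` that has a nonzero nonnegative eigenvector. -/
def IsDistinguishedEigenvalue {ι : Type*} [Fintype ι] (A : Matrix ι ι ℝ) (t : ℝ) : Prop :=
  0 ≤ t ∧ ∃ v : ι → ℝ, v ≠ 0 ∧ (∀ i, 0 ≤ v i) ∧ A.mulVec v = t • v

/-- The set of distinguished eigenvalues of `A`. -/
def distinguishedSpectrum {ι : Type*} [Fintype ι] (A : Matrix ι ι ℝ) : Set ℝ :=
  {t | IsDistinguishedEigenvalue A t}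

/-- The Perron root: the largest distinguished eigenvalue.  For a nonnegative matrix over a
nonempty index type this set is finite and, by the Perron-Frobenius theorem, nonempty, so that
the supremum is a maximum. -/
def perronRoot {ι : Type*} [Fintype ι] (A : Matrix ι ι ℝ) : ℝ :=
  sSup (distinguishedSpectrum A)

/-- Access in the digraph of `A`, whose edges are the pairs `(i, j)` with `A i j > 0`:
there is a path, possibly of length `0`, from `i` to `j`. -/
def Access {ι : Type*} (A : Matrix ι ι ℝ) : ι → ι → Prop :=
  Relation.ReflTransGen fun i j => 0 < A i j

/-- The classes of `A`: the (vertex sets of the) strongly connected components of its digraph. -/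
def classes {ι : Type*} (A : Matrix ι ι ℝ) : Set (Finset ι) :=
  {μ | ∃ i, ∀ j, j ∈ μ ↔ Access A i j ∧ Access A j i}

/-- The edges of the reduced digraph of `A`, whose nodes are the classes of `A`. -/
def ReducedEdge {ι : Type*} (A : Matrix ι ι ℝ) (μ ν : Finset ι) : Prop :=
  μ ∈ classes A ∧ ν ∈ classes A ∧ ∃ i ∈ μ, ∃ j ∈ ν, 0 < A i j

/-- The class `μ` has access to the class `ν`: they are equal, or there is a path from `μ` to `ν`
in the reduced digraph.  This is the edge relation of the transitive closure of the reduced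
digraph. -/
def ClassAccess {ι : Type*} (A : Matrix ι ι ℝ) (μ ν : Finset ι) : Prop :=
  μ ∈ classes A ∧ ν ∈ classes A ∧ (μ = ν ∨ Relation.TransGen (ReducedEdge A) μ ν)

/-- The Perron root of a class `μ`: that of the principal submatrix of `A` with index set `μ`. -/
def classRoot {ι : Type*} (A : Matrix ι ι ℝ) (μ : Finset ι) : ℝ :=
  perronRoot (A.submatrix (fun i : {i // i ∈ μ} => (i : ι)) (fun i : {i // i ∈ μ} => (i : ι)))

/-- An initial class: no other class has access to it. -/
def IsInitialClass {ι : Type*} (A : Matrix ι ι ℝ) (ν : Finset ι) : Prop :=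
  ν ∈ classes A ∧ ∀ μ, ClassAccess A μ ν → μ = ν

/-- A spectral class. -/
def IsSpectralClass {ι : Type*} (A : Matrix ι ι ℝ) (ν : Finset ι) : Prop :=
  ν ∈ classes A ∧
    (IsInitialClass A ν ∨
      (0 < classRoot A ν ∧ ∀ μ, ClassAccess A μ ν → classRoot A μ ≤ classRoot A ν))

/-- A premier spectral class. -/
def IsPremierSpectralClass {ι : Type*} (A : Matrix ι ι ℝ) (ν : Finset ι) : Prop :=
  IsSpectralClass A ν ∧ ∀ μ, ClassAccess A μ ν → μ ≠ ν → classRoot A μ < classRoot A ν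

/-- The value `p(A₁, …, A_r)` of a real polynomial at a tuple of square matrices, each monomial
being evaluated as `A₁ ^ m₁ * ⋯ * A_r ^ m_r` (for pairwise commuting matrices the order of the
factors is irrelevant). -/
def polyEval {ι : Type*} [Fintype ι] [DecidableEq ι] {r : ℕ}
    (p : MvPolynomial (Fin r) ℝ) (A : Fin r → Matrix ι ι ℝ) : Matrix ι ι ℝ :=
  ∑ m ∈ p.support, p.coeff m • (List.ofFn fun k => A k ^ m k).prod

end NonnegMatrix

end

/-! Each `A k` is compared with S = A₁ + ⋯ + A_r, which dominates it and commutes with it; two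
pairing arguments show that both have the same access relation. On a class of S, the block of `A k`
commutes with the irreducible block of S, so it has positive right and left eigenvectors. These
exclude one-way edges (`access_symm_of_pos_vectors`), so the classes of `A k` inside this class all
have the same Perron root; as roots are distinct, there is only one. If μ, ν are consecutive classes
joined by an edge of S but by none of `A k`, then for Perron vectors y (left, on μ) and x (right, on
ν) the equality yᵀ(AS)x = yᵀ(SA)x reads α_μ yᵀSx = α_ν yᵀSx with yᵀSx > 0, against distinctness
(`exists_edge_of_covering`). Induction on the indices between two nodes gives (i) and (ii).

For (iii) and (iv), a final class in the support of a nonnegative eigenvector is premier spectral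
and its root is the eigenvalue (`premier_of_final_class`); conversely every premier spectral class
carries such an eigenvector (`distinguished_of_premier`). If P commutes with all `A k`, an
eigenspace of P meeting the nonnegative cone contains a common nonnegative eigenvector of the family
(`exists_common_eigenvector_mem`). Its support has a final class that serves every `A k`, because
access is common. Taking P = `A k` identifies the premier classes; taking P = p(A₁, …, A_r) gives
(iv). -/

open Matrix

namespace NonnegMatrix

/-! ### Nonnegative eigenvectors in invariant subspaces -/

/-- A subspace of `ℝ^ι` contains a nonnegative vector whose support contains the supports of all
other nonnegative vectors of the subspace. -/
theorem exists_maximal_support {ι : Type*} [Fintype ι] (V : Submodule ℝ (ι → ℝ)) :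
    ∃ u ∈ V, (∀ i, 0 ≤ u i) ∧ ∀ w ∈ V, (∀ i, 0 ≤ w i) → ∀ i, 0 < w i → 0 < u i := by
  classical
  have h : ∀ i, ∃ v ∈ V, (∀ j, 0 ≤ v j) ∧ ((∃ w ∈ V, (∀ j, 0 ≤ w j) ∧ 0 < w i) → 0 < v i) := by
    intro i
    by_cases hi : ∃ w ∈ V, (∀ j, 0 ≤ w j) ∧ 0 < w i
    · obtain ⟨w, hw, h0, hwi⟩ := hi
      exact ⟨w, hw, h0, fun _ => hwi⟩
    · exact ⟨0, V.zero_mem, fun _ => le_rfl, fun h => absurd h hi⟩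
  choose v hvV hv0 hv using h
  refine ⟨∑ i, v i, V.sum_mem fun i _ => hvV i, fun j => ?_, fun w hw hw0 i hi => ?_⟩
  · rw [Finset.sum_apply]
    exact Finset.sum_nonneg fun i _ => hv0 i j
  · rw [Finset.sum_apply]
    exact Finset.sum_pos' (fun k _ => hv0 k i) ⟨i, Finset.mem_univ i, hv i ⟨w, hw, hw0, hi⟩⟩

theorem sum_pos_of_ne_zero {ι : Type*} [Fintype ι] {w : ι → ℝ} (h0 : ∀ i, 0 ≤ w i)
    (hw : w ≠ 0) : 0 < ∑ i, w i := by
  obtain ⟨i, hi⟩ := Function.ne_iff.mp hw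
  exact Finset.sum_pos' (fun k _ => h0 k) ⟨i, Finset.mem_univ i, lt_of_le_of_ne (h0 i) (Ne.symm hi)⟩

theorem mulVec_nonneg {ι : Type*} [Fintype ι] {B : Matrix ι ι ℝ} (hB : ∀ i j, 0 ≤ B i j)
    {w : ι → ℝ} (hw : ∀ i, 0 ≤ w i) (i : ι) : 0 ≤ (B *ᵥ w) i :=
  Finset.sum_nonneg fun j _ => mul_nonneg (hB i j) (hw j)

/-- The nonnegative vectors of a subspace with coordinate sum `1`. -/
def simplexIn {ι : Type*} [Fintype ι] (V : Submodule ℝ (ι → ℝ)) : Set (ι → ℝ) :=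
  {w | w ∈ V ∧ (∀ i, 0 ≤ w i) ∧ ∑ i, w i = 1}

theorem isCompact_simplexIn {ι : Type*} [Fintype ι] (V : Submodule ℝ (ι → ℝ)) :
    IsCompact (simplexIn V) := by
  refine (isCompact_stdSimplex ℝ ι).of_isClosed_subset ?_ fun w hw => ⟨hw.2.1, hw.2.2⟩
  have : simplexIn V = (V : Set (ι → ℝ)) ∩ stdSimplex ℝ ι := by
    ext w
    rfl
  rw [this]
  exact V.closed_of_finiteDimensional.inter (isClosed_stdSimplex ℝ ι)

theorem normalize_mem_simplexIn {ι : Type*} [Fintype ι] {V : Submodule ℝ (ι → ℝ)} {w : ι → ℝ}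
    (hw : w ∈ V) (h0 : ∀ i, 0 ≤ w i) (hne : w ≠ 0) : (∑ i, w i)⁻¹ • w ∈ simplexIn V := by
  have hs := sum_pos_of_ne_zero h0 hne
  refine ⟨V.smul_mem _ hw, fun i => mul_nonneg (inv_nonneg.2 hs.le) (h0 i), ?_⟩
  simp only [Pi.smul_apply, smul_eq_mul, ← Finset.mul_sum]
  exact inv_mul_cancel₀ hs.ne'

/-- The rank-one perturbation of a nonnegative matrix in the direction of an order unit of the
cone of nonnegative vectors of an invariant subspace has an eigenvector in this cone. -/
theorem exists_perturbed_eigenvector {ι : Type*} [Fintype ι] {B : Matrix ι ι ℝ}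
    (hB : ∀ i j, 0 ≤ B i j) {V : Submodule ℝ (ι → ℝ)} (hV : ∀ v ∈ V, B *ᵥ v ∈ V) {u : ι → ℝ}
    (huV : u ∈ V) (hu0 : ∀ i, 0 ≤ u i) (hune : u ≠ 0)
    (hu : ∀ w ∈ V, (∀ i, 0 ≤ w i) → ∀ i, 0 < w i → 0 < u i) {ε : ℝ} (hε : 0 < ε) :
    ∃ w ∈ simplexIn V, ∃ t : ℝ, B *ᵥ w + ε • u = t • w := by
  have hsu := sum_pos_of_ne_zero hu0 hune
  set C : ℝ := ∑ i, ((∑ j, B i j) + ε * u i) with hC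
  have hbound : ∀ w ∈ simplexIn V, ∀ t : ℝ, (∀ i, t * w i ≤ (B *ᵥ w) i + ε * u i) → t ≤ C := by
    rintro w ⟨-, h0, h1⟩ t ht
    have hw1 : ∀ i, w i ≤ 1 := fun i => by
      rw [← h1]
      exact Finset.single_le_sum (fun j _ => h0 j) (Finset.mem_univ i)
    calc t = ∑ i, t * w i := by rw [← Finset.mul_sum, h1, mul_one]
      _ ≤ ∑ i, ((B *ᵥ w) i + ε * u i) := Finset.sum_le_sum fun i _ => ht i
      _ ≤ C := Finset.sum_le_sum fun i _ => add_le_add (Finset.sum_le_sum fun j _ =>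
          mul_le_of_le_one_right (hB i j) (hw1 j)) le_rfl
  have hC0 : 0 ≤ C := Finset.sum_nonneg fun i _ =>
    add_nonneg (Finset.sum_nonneg fun j _ => hB i j) (mul_nonneg hε.le (hu0 i))
  -- Collatz–Wielandt: the eigenvector is a point where the largest feasible `t` is attained; the
  -- bound `C` only serves to make the feasible set compact.
  let G : Set (ℝ × (ι → ℝ)) := (Set.Icc 0 C ×ˢ simplexIn V) ∩
    {q | ∀ i, q.1 * q.2 i ≤ (B *ᵥ q.2) i + ε * u i}
  have hG : IsCompact G := by
    refine (isCompact_Icc.prod (isCompact_simplexIn V)).inter_right ?_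
    simp only [Set.ofPred_forall]
    refine isClosed_iInter fun i => isClosed_le (by fun_prop) ?_
    simp only [mulVec, dotProduct]
    fun_prop
  have hGne : G.Nonempty := by
    refine ⟨(0, (∑ i, u i)⁻¹ • u), ⟨⟨le_rfl, hC0⟩, normalize_mem_simplexIn huV hu0 hune⟩, fun i => ?_⟩
    have := mulVec_nonneg hB (normalize_mem_simplexIn huV hu0 hune).2.1 i
    have := mul_nonneg hε.le (hu0 i)
    simp only [zero_mul]
    linarith
  obtain ⟨⟨t, w⟩, ⟨⟨ht, hw⟩, hq⟩, hmax⟩ := hG.exists_isMaxOn hGne continuous_fst.continuousOn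
  refine ⟨w, hw, t, ?_⟩
  by_contra hne
  simp only [Set.mem_ofPred_eq] at hq ht hw
  have hw'V : B *ᵥ w + ε • u ∈ V := V.add_mem (hV w hw.1) (V.smul_mem _ huV)
  -- Put T = B + ε u 1ᵀ, so that `w'` = Tw on the simplex. If the slack `z` = Tw - tw is nonzero,
  -- then Tz ≥ ε(∑ z)u ≥ δw', that is, Tw' ≥ (t + δ)w', and the normalized `w'` beats the maximum.
  set w' := B *ᵥ w + ε • u with hw'
  have hw'i : ∀ i, w' i = (B *ᵥ w) i + ε * u i := fun i => rfl
  set z := w' - t • w with hz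
  have hz0 : ∀ i, 0 ≤ z i := fun i => by
    have := hq i
    simp only [hz, Pi.sub_apply, Pi.smul_apply, smul_eq_mul, hw'i]
    linarith
  have hzne : z ≠ 0 := fun h => hne (sub_eq_zero.mp h)
  have hsz := sum_pos_of_ne_zero hz0 hzne
  have hw'u : ∀ i, ε * u i ≤ w' i := fun i => by
    have := mulVec_nonneg hB hw.2.1 i
    rw [hw'i]
    linarith
  have hw'0 : ∀ i, 0 ≤ w' i := fun i => (mul_nonneg hε.le (hu0 i)).trans (hw'u i)
  have hsw' : 0 < ∑ i, w' i :=
    lt_of_lt_of_le (by rw [← Finset.mul_sum]; positivity) (Finset.sum_le_sum fun i _ => hw'u i)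
  have hw'ne : w' ≠ 0 := fun h => by simp [h] at hsw'
  -- This is where maximality of the support of `u` enters: `w'` vanishes wherever `u` does.
  obtain ⟨D, hD, hDu⟩ : ∃ D : ℝ, 0 < D ∧ ∀ i, w' i ≤ D * u i := by
    refine ⟨1 + ∑ i, w' i / u i, ?_, fun i => ?_⟩
    · have : 0 ≤ ∑ i, w' i / u i := Finset.sum_nonneg fun i _ => div_nonneg (hw'0 i) (hu0 i)
      linarith
    · rcases (hw'0 i).eq_or_lt with h | h
      · rw [← h]
        refine mul_nonneg ?_ (hu0 i)
        have : 0 ≤ ∑ i, w' i / u i := Finset.sum_nonneg fun i _ => div_nonneg (hw'0 i) (hu0 i)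
        linarith
      · have hui := hu w' hw'V hw'0 i h
        have : w' i / u i ≤ ∑ i, w' i / u i :=
          Finset.single_le_sum (f := fun i => w' i / u i)
            (fun i _ => div_nonneg (hw'0 i) (hu0 i)) (Finset.mem_univ i)
        rw [← div_le_iff₀ hui]
        linarith
  have hszw : ∑ i, z i = ∑ i, w' i - t := by
    simp only [hz, Pi.sub_apply, Pi.smul_apply, smul_eq_mul, Finset.sum_sub_distrib,
      ← Finset.mul_sum, hw.2.2, mul_one]
  set δ := ε * (∑ i, z i) / D with hδ
  have hδ0 : 0 < δ := by positivity
  have key : ∀ i, (t + δ) * w' i ≤ (B *ᵥ w') i + ε * (∑ j, w' j) * u i := by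
    intro i
    have h1 : (B *ᵥ z) i = (B *ᵥ w') i - t * (B *ᵥ w) i := by
      rw [hz, mulVec_sub, mulVec_smul]
      rfl
    have h2 := mulVec_nonneg hB hz0 i
    have h3 : δ * w' i ≤ ε * (∑ i, z i) * u i := by
      calc δ * w' i ≤ δ * (D * u i) := mul_le_mul_of_nonneg_left (hDu i) hδ0.le
        _ = ε * (∑ i, z i) * u i := by
          rw [hδ]
          field_simp
    rw [hszw] at h3
    have h4 : t * w' i = t * (B *ᵥ w) i + t * (ε * u i) := by rw [hw'i]; ring
    nlinarith
  have hmem := normalize_mem_simplexIn hw'V hw'0 hw'ne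
  have key' : ∀ i, (t + δ) * ((∑ i, w' i)⁻¹ • w') i ≤
      (B *ᵥ ((∑ i, w' i)⁻¹ • w')) i + ε * u i := by
    intro i
    rw [mulVec_smul]
    simp only [Pi.smul_apply, smul_eq_mul]
    have := mul_le_mul_of_nonneg_left (key i) (inv_nonneg.2 hsw'.le)
    calc _ = (∑ i, w' i)⁻¹ * ((t + δ) * w' i) := by ring
      _ ≤ _ := this
      _ = _ := by field_simp
  have := hmax (show (t + δ, (∑ i, w' i)⁻¹ • w') ∈ G from
    ⟨⟨⟨by linarith [ht.1], hbound _ hmem _ key'⟩, hmem⟩, key'⟩)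
  simp only [Set.mem_ofPred_eq] at this
  linarith

/-- A nonnegative matrix has a nonnegative eigenvector in every invariant subspace that contains a
nonzero nonnegative vector. -/
theorem exists_eigenvector_mem {ι : Type*} [Fintype ι] {B : Matrix ι ι ℝ}
    (hB : ∀ i j, 0 ≤ B i j) {V : Submodule ℝ (ι → ℝ)} (hV : ∀ v ∈ V, B *ᵥ v ∈ V)
    (hne : ∃ v ∈ V, v ≠ 0 ∧ ∀ i, 0 ≤ v i) :
    ∃ w ∈ V, w ≠ 0 ∧ (∀ i, 0 ≤ w i) ∧ ∃ t : ℝ, 0 ≤ t ∧ B *ᵥ w = t • w := by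
  obtain ⟨v, hvV, hvne, hv0⟩ := hne
  obtain ⟨u, huV, hu0, hu⟩ := exists_maximal_support V
  have hune : u ≠ 0 := by
    obtain ⟨i, hi⟩ := Function.ne_iff.mp hvne
    exact fun h => (hu v hvV hv0 i (lt_of_le_of_ne (hv0 i) (Ne.symm hi))).ne' (by simp [h])
  -- On the simplex an eigenvalue must equal the coordinate sum of `B *ᵥ w`, so the residual depends
  -- continuously on `w` alone. Its minimum is at most its value at the perturbed eigenvectors,
  -- which is O(ε), hence it is zero.
  let g : (ι → ℝ) → ℝ := fun w => ∑ i, |(B *ᵥ w) i - (∑ j, (B *ᵥ w) j) * w i|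
  have hg : Continuous g := by
    simp only [g, mulVec, dotProduct]
    fun_prop
  obtain ⟨w, hw, hmin⟩ := (isCompact_simplexIn V).exists_isMinOn
    ⟨_, normalize_mem_simplexIn hvV hv0 hvne⟩ hg.continuousOn
  have hsmall : ∀ ε : ℝ, 0 < ε → g w ≤ ε * ∑ i, (u i + ∑ j, u j) := by
    intro ε hε
    obtain ⟨x, hx, t, hxt⟩ := exists_perturbed_eigenvector hB hV huV hu0 hune hu hε
    refine (hmin hx).trans ?_
    have hxi : ∀ i, (B *ᵥ x) i + ε * u i = t * x i := fun i => congrFun hxt i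
    have ht : t = (∑ i, (B *ᵥ x) i) + ε * ∑ i, u i := by
      rw [Finset.mul_sum, ← Finset.sum_add_distrib, Finset.sum_congr rfl fun i _ => hxi i,
        ← Finset.mul_sum, hx.2.2, mul_one]
    rw [Finset.mul_sum]
    refine Finset.sum_le_sum fun i _ => ?_
    have hx1 : x i ≤ 1 := by
      rw [← hx.2.2]
      exact Finset.single_le_sum (fun j _ => hx.2.1 j) (Finset.mem_univ i)
    have hsu := (sum_pos_of_ne_zero hu0 hune).le
    have e : (B *ᵥ x) i - (∑ j, (B *ᵥ x) j) * x i = ε * ((∑ j, u j) * x i - u i) := by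
      have := hxi i
      rw [ht] at this
      linear_combination this
    rw [e, abs_mul, abs_of_pos hε]
    refine mul_le_mul_of_nonneg_left ?_ hε.le
    have h1 := mul_nonneg hsu (hx.2.1 i)
    have h2 := mul_le_of_le_one_right hsu hx1
    have h3 := hu0 i
    rw [abs_le]
    constructor <;> linarith
  have hg0 : g w ≤ 0 := by
    refine le_of_forall_pos_le_add fun η hη => ?_
    have hc : 0 < ∑ i, (u i + ∑ j, u j) + 1 := by
      have : 0 ≤ ∑ i, (u i + ∑ j, u j) :=
        Finset.sum_nonneg fun i _ => add_nonneg (hu0 i) (Finset.sum_nonneg fun j _ => hu0 j)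
      linarith
    refine (hsmall (η / (∑ i, (u i + ∑ j, u j) + 1)) (by positivity)).trans ?_
    rw [zero_add, div_mul_eq_mul_div, div_le_iff₀ hc]
    nlinarith
  have hnn : ∀ i ∈ Finset.univ, 0 ≤ |(B *ᵥ w) i - (∑ j, (B *ᵥ w) j) * w i| :=
    fun i _ => abs_nonneg _
  refine ⟨w, hw.1, fun h => ?_, hw.2.1, ∑ j, (B *ᵥ w) j,
    Finset.sum_nonneg fun j _ => mulVec_nonneg hB hw.2.1 j, funext fun i => ?_⟩
  · have := hw.2.2
    simp [h] at this
  · have := (Finset.sum_eq_zero_iff_of_nonneg hnn).1 (le_antisymm hg0 (Finset.sum_nonneg hnn)) i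
      (Finset.mem_univ i)
    exact sub_eq_zero.mp (abs_eq_zero.mp this)

/-- A commuting family of nonnegative matrices has a common nonnegative eigenvector in every
invariant subspace that contains a nonzero nonnegative vector. -/
theorem exists_common_eigenvector_mem {ι κ : Type*} [Fintype ι] [Finite κ] {B : κ → Matrix ι ι ℝ}
    (hB : ∀ k i j, 0 ≤ B k i j) (hcomm : ∀ k l, B k * B l = B l * B k)
    {V : Submodule ℝ (ι → ℝ)} (hV : ∀ k, ∀ v ∈ V, B k *ᵥ v ∈ V)
    (hne : ∃ v ∈ V, v ≠ 0 ∧ ∀ i, 0 ≤ v i) :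
    ∃ w ∈ V, w ≠ 0 ∧ (∀ i, 0 ≤ w i) ∧ ∃ t : κ → ℝ, ∀ k, 0 ≤ t k ∧ B k *ᵥ w = t k • w := by
  classical
  have : Fintype κ := Fintype.ofFinite κ
  suffices h : ∀ s : Finset κ, ∃ w ∈ V, w ≠ 0 ∧ (∀ i, 0 ≤ w i) ∧
      ∃ t : κ → ℝ, ∀ k ∈ s, 0 ≤ t k ∧ B k *ᵥ w = t k • w by
    simpa using h Finset.univ
  intro s
  induction s using Finset.induction_on with
  | empty =>
    obtain ⟨v, hv, h1, h2⟩ := hne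
    exact ⟨v, hv, h1, h2, 0, by simp⟩
  | insert a s ha ih =>
    obtain ⟨v, hv, hvne, hv0, t, ht⟩ := ih
    -- The joint eigenspace for the matrices already treated; commutation makes it invariant under
    -- `B a`.
    let W : Submodule ℝ (ι → ℝ) :=
      V ⊓ ⨅ k ∈ s, LinearMap.ker ((B k).mulVecLin - t k • LinearMap.id)
    have hW : ∀ x, x ∈ W ↔ x ∈ V ∧ ∀ k ∈ s, B k *ᵥ x = t k • x := by
      intro x
      simp [W, Submodule.mem_iInf, sub_eq_zero]
    obtain ⟨w, hw, hwne, hw0, τ, hτ, hwτ⟩ := exists_eigenvector_mem (hB a) (V := W)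
      (fun x hx => by
        rw [hW] at hx ⊢
        refine ⟨hV a x hx.1, fun k hk => ?_⟩
        rw [mulVec_mulVec, hcomm, ← mulVec_mulVec, hx.2 k hk, mulVec_smul])
      ⟨v, (hW v).2 ⟨hv, fun k hk => (ht k hk).2⟩, hvne, hv0⟩
    rw [hW] at hw
    refine ⟨w, hw.1, hwne, hw0, Function.update t a τ, fun k hk => ?_⟩
    by_cases hka : k = a
    · subst hka
      simpa using ⟨hτ, hwτ⟩
    · have hks : k ∈ s := (Finset.mem_insert.1 hk).resolve_left hka
      rw [Function.update_of_ne hka]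
      exact ⟨(ht k hks).1, hw.2 k hks⟩

/-! ### Access and classes -/

theorem Access.trans {ι : Type*} {A : Matrix ι ι ℝ} {i j k : ι} (h : Access A i j)
    (h' : Access A j k) : Access A i k :=
  Relation.ReflTransGen.trans h h'

theorem Access.single {ι : Type*} {A : Matrix ι ι ℝ} {i j : ι} (h : 0 < A i j) : Access A i j :=
  Relation.ReflTransGen.single h

theorem Access.refl {ι : Type*} {A : Matrix ι ι ℝ} (i : ι) : Access A i i :=
  Relation.ReflTransGen.refl

theorem access_transpose {ι : Type*} {A : Matrix ι ι ℝ} {i j : ι} :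
    Access Aᵀ i j ↔ Access A j i :=
  Relation.reflTransGen_swap (r := fun i j => 0 < A i j)

theorem classes_transpose {ι : Type*} (A : Matrix ι ι ℝ) : classes Aᵀ = classes A := by
  ext μ
  simp only [classes, Set.mem_ofPred_eq, access_transpose, and_comm]

theorem exists_mem_class {ι : Type*} {A : Matrix ι ι ℝ} {σ : Finset ι} (hσ : σ ∈ classes A) :
    ∃ i, i ∈ σ := by
  obtain ⟨i, hi⟩ := hσ
  exact ⟨i, (hi i).2 ⟨.refl i, .refl i⟩⟩

theorem mem_class_iff {ι : Type*} {A : Matrix ι ι ℝ} {σ : Finset ι} (hσ : σ ∈ classes A)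
    {i : ι} (hi : i ∈ σ) (j : ι) : j ∈ σ ↔ Access A i j ∧ Access A j i := by
  obtain ⟨k, hk⟩ := hσ
  have h := (hk i).1 hi
  rw [hk]
  exact ⟨fun h' => ⟨h.2.trans h'.1, h'.2.trans h.1⟩, fun h' => ⟨h.1.trans h'.1, h'.2.trans h.2⟩⟩

theorem exists_class {ι : Type*} [Fintype ι] (A : Matrix ι ι ℝ) (i : ι) :
    ∃ σ ∈ classes A, i ∈ σ := by
  classical
  refine ⟨Finset.univ.filter fun j => Access A i j ∧ Access A j i, ⟨i, fun j => by simp⟩, ?_⟩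
  simpa using Access.refl i

theorem class_eq_of_mem {ι : Type*} {A : Matrix ι ι ℝ} {σ τ : Finset ι} (hσ : σ ∈ classes A)
    (hτ : τ ∈ classes A) {i : ι} (hi : i ∈ σ) (hi' : i ∈ τ) : σ = τ := by
  ext j
  rw [mem_class_iff hσ hi, mem_class_iff hτ hi']

/-! ### Perron–Frobenius theory of a single class -/

/-- The matrix `A` with all entries outside `σ × σ` replaced by `0`. -/
def trunc {ι : Type*} [DecidableEq ι] (A : Matrix ι ι ℝ) (σ : Finset ι) : Matrix ι ι ℝ :=
  Matrix.of fun i j => if i ∈ σ ∧ j ∈ σ then A i j else 0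

theorem trunc_nonneg {ι : Type*} [DecidableEq ι] {A : Matrix ι ι ℝ} (hA : ∀ i j, 0 ≤ A i j)
    (σ : Finset ι) (i j : ι) : 0 ≤ trunc A σ i j := by
  simp only [trunc, of_apply]
  split_ifs
  exacts [hA i j, le_rfl]

theorem trunc_mulVec {ι : Type*} [Fintype ι] [DecidableEq ι] (A : Matrix ι ι ℝ) (σ : Finset ι)
    (w : ι → ℝ) (i : ι) :
    (trunc A σ *ᵥ w) i = if i ∈ σ then ∑ j ∈ σ, A i j * w j else 0 := by
  simp only [mulVec, dotProduct, trunc, of_apply]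
  split_ifs with h
  · simp [h, Finset.sum_ite_mem]
  · simp [h]

/-- The vectors that vanish outside `σ`. -/
def supportedIn {ι : Type*} (σ : Finset ι) : Submodule ℝ (ι → ℝ) where
  carrier := {w | ∀ i, i ∉ σ → w i = 0}
  add_mem' := fun ha hb i hi => by simp [ha i hi, hb i hi]
  zero_mem' := fun _ _ => rfl
  smul_mem' := fun c a ha i hi => by simp [ha i hi]

theorem trunc_mulVec_mem {ι : Type*} [Fintype ι] [DecidableEq ι] (A : Matrix ι ι ℝ)
    (σ : Finset ι) (w : ι → ℝ) : trunc A σ *ᵥ w ∈ supportedIn σ := fun i hi => by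
  rw [trunc_mulVec, if_neg hi]

theorem exists_supportedIn_nonneg {ι : Type*} [DecidableEq ι] {σ : Finset ι} (h : ∃ i, i ∈ σ) :
    ∃ v ∈ supportedIn σ, v ≠ 0 ∧ ∀ i, 0 ≤ v i := by
  obtain ⟨i, hi⟩ := h
  refine ⟨Pi.single i 1, fun j hj => ?_, by simp, fun j => ?_⟩
  · have hji : j ≠ i := by
      rintro rfl
      exact hj hi
    exact Pi.single_eq_of_ne hji _
  · by_cases h : j = i
    · subst h
      simp
    · simp [h]

/-- A nonnegative eigenvector is positive wherever there is access to its support. -/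
theorem pos_of_access {ι : Type*} [Fintype ι] {A : Matrix ι ι ℝ} (hA : ∀ i j, 0 ≤ A i j)
    {w : ι → ℝ} (hw : ∀ i, 0 ≤ w i) {t : ℝ} (hAw : A *ᵥ w = t • w) {i j : ι}
    (h : Access A i j) (hj : 0 < w j) : 0 < w i := by
  induction h using Relation.ReflTransGen.head_induction_on with
  | refl => exact hj
  | head hab _ ih =>
    rename_i a b _
    refine lt_of_le_of_ne (hw a) fun h0 => ?_
    have h1 : (A *ᵥ w) a = 0 := by rw [hAw, Pi.smul_apply, ← h0, smul_zero]
    have h2 : A a b * w b ≤ (A *ᵥ w) a :=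
      Finset.single_le_sum (f := fun j => A a j * w j) (fun j _ => mul_nonneg (hA a j) (hw j))
        (Finset.mem_univ b)
    have := mul_pos hab ih
    linarith

/-- A path between two elements of a class never leaves the class, so truncation keeps all its
edges; this is irreducibility of the diagonal block. -/
theorem access_trunc {ι : Type*} [DecidableEq ι] {A : Matrix ι ι ℝ} {σ : Finset ι}
    (hσ : σ ∈ classes A) {i j : ι} (hi : i ∈ σ) (hj : j ∈ σ) : Access (trunc A σ) i j := by
  have h := ((mem_class_iff hσ hi j).1 hj).1
  revert hi
  induction h using Relation.ReflTransGen.head_induction_on with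
  | refl => exact fun _ => .refl j
  | head hab hbj ih =>
    rename_i a b
    intro ha
    have hb : b ∈ σ := (mem_class_iff hσ ha b).2
      ⟨.single hab, Access.trans hbj ((mem_class_iff hσ ha j).1 hj).2⟩
    refine Access.trans (.single ?_) (ih hb)
    simpa [trunc, ha, hb] using hab

/-- The truncation of a nonnegative matrix to one of its classes has an eigenvector that is
positive on this class. -/
theorem exists_pos_eigenvector_class {ι : Type*} [Fintype ι] {A : Matrix ι ι ℝ}
    (hA : ∀ i j, 0 ≤ A i j) {σ : Finset ι} (hσ : σ ∈ classes A) :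
    ∃ x : ι → ℝ, (∀ i ∈ σ, 0 < x i) ∧ (∀ i ∉ σ, x i = 0) ∧
      ∃ t, 0 ≤ t ∧ ∀ i ∈ σ, ∑ j ∈ σ, A i j * x j = t * x i := by
  classical
  obtain ⟨x, hx, hne, hx0, t, ht, hAx⟩ := exists_eigenvector_mem (trunc_nonneg hA σ)
    (fun v _ => trunc_mulVec_mem A σ v) (exists_supportedIn_nonneg (exists_mem_class hσ))
  obtain ⟨j, hj⟩ := Function.ne_iff.mp hne
  have hjσ : j ∈ σ := by
    by_contra h
    exact hj (hx j h)
  have hjp : 0 < x j := lt_of_le_of_ne (hx0 j) (Ne.symm hj)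
  refine ⟨x, fun i hi => pos_of_access (trunc_nonneg hA σ) hx0 hAx (access_trunc hσ hi hjσ) hjp,
    hx, t, ht, fun i hi => ?_⟩
  have := congrFun hAx i
  rwa [trunc_mulVec, if_pos hi] at this

theorem isDistinguishedEigenvalue_submatrix {ι : Type*} {A : Matrix ι ι ℝ}
    {σ : Finset ι} {t : ℝ} :
    IsDistinguishedEigenvalue
      (A.submatrix (fun i : {i // i ∈ σ} => (i : ι)) (fun i : {i // i ∈ σ} => (i : ι))) t ↔
    0 ≤ t ∧ ∃ w : ι → ℝ, (∃ i ∈ σ, w i ≠ 0) ∧ (∀ i ∈ σ, 0 ≤ w i) ∧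
      ∀ i ∈ σ, ∑ j ∈ σ, A i j * w j = t * w i := by
  classical
  have hsum : ∀ (w : ι → ℝ) (i : {i // i ∈ σ}),
      (A.submatrix (fun i : {i // i ∈ σ} => (i : ι)) (fun i : {i // i ∈ σ} => (i : ι)) *ᵥ
        fun j => w j) i = ∑ j ∈ σ, A i j * w j := by
    intro w i
    simp only [mulVec, dotProduct, submatrix_apply]
    exact Finset.sum_coe_sort σ fun j => A i j * w j
  refine and_congr_right fun _ => ⟨?_, ?_⟩
  · rintro ⟨v, hne, h0, hv⟩
    obtain ⟨w, rfl⟩ : ∃ w : ι → ℝ, v = fun j : {i // i ∈ σ} => w j :=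
      ⟨fun i => if h : i ∈ σ then v ⟨i, h⟩ else 0, by ext j; simp⟩
    obtain ⟨i, hi⟩ := Function.ne_iff.mp hne
    refine ⟨w, ⟨i, i.2, hi⟩, fun i hi => h0 ⟨i, hi⟩, fun i hi => ?_⟩
    have := congrFun hv ⟨i, hi⟩
    rwa [hsum] at this
  · rintro ⟨w, ⟨i, hi, hwi⟩, h0, hw⟩
    refine ⟨fun j => w j, fun h => hwi (congrFun h ⟨i, hi⟩), fun i => h0 i i.2, ?_⟩
    ext i
    rw [hsum]
    exact hw i i.2

/-- Evaluating yᵀAw through the left eigenvector `y`. With `y` positive, comparison with an equation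
or inequality for Aw pins down or bounds the eigenvalue; this drives all uniqueness statements
below. -/
theorem sum_pairing {ι : Type*} {A : Matrix ι ι ℝ} {σ : Finset ι} {y w : ι → ℝ} {t : ℝ}
    (hy : ∀ j ∈ σ, ∑ i ∈ σ, y i * A i j = t * y j) :
    ∑ i ∈ σ, y i * ∑ j ∈ σ, A i j * w j = t * ∑ i ∈ σ, y i * w i := by
  simp only [Finset.mul_sum]
  rw [Finset.sum_comm]
  refine Finset.sum_congr rfl fun j hj => ?_
  rw [← mul_assoc, ← hy j hj, Finset.sum_mul]
  exact Finset.sum_congr rfl fun i _ => (mul_assoc _ _ _).symm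

theorem sum_pairing_pos {ι : Type*} {σ : Finset ι} {y w : ι → ℝ} (hy : ∀ i ∈ σ, 0 < y i)
    (hw : ∀ i ∈ σ, 0 ≤ w i) (hne : ∃ i ∈ σ, w i ≠ 0) : 0 < ∑ i ∈ σ, y i * w i := by
  obtain ⟨i, hi, h⟩ := hne
  exact Finset.sum_pos' (fun j hj => mul_nonneg (hy j hj).le (hw j hj))
    ⟨i, hi, mul_pos (hy i hi) (lt_of_le_of_ne (hw i hi) h.symm)⟩

/-- Perron-Frobenius theorem for a class: positive right and left eigenvectors for the Perron
root. -/
theorem exists_perron_vectors {ι : Type*} [Fintype ι] {A : Matrix ι ι ℝ}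
    (hA : ∀ i j, 0 ≤ A i j) {σ : Finset ι} (hσ : σ ∈ classes A) :
    0 ≤ classRoot A σ ∧ ∃ x y : ι → ℝ, (∀ i ∈ σ, 0 < x i) ∧ (∀ i ∉ σ, x i = 0) ∧
      (∀ i ∈ σ, 0 < y i) ∧ (∀ i ∉ σ, y i = 0) ∧
      (∀ i ∈ σ, ∑ j ∈ σ, A i j * x j = classRoot A σ * x i) ∧
      (∀ j ∈ σ, ∑ i ∈ σ, y i * A i j = classRoot A σ * y j) := by
  obtain ⟨x, hx, hx', t, ht, hAx⟩ := exists_pos_eigenvector_class hA hσ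
  obtain ⟨y, hy, hy', s, hs, hAy⟩ := exists_pos_eigenvector_class (A := Aᵀ)
    (fun i j => hA j i) (by rwa [classes_transpose])
  have hAy' : ∀ j ∈ σ, ∑ i ∈ σ, y i * A i j = s * y j := fun j hj => by
    rw [← hAy j hj]
    exact Finset.sum_congr rfl fun i _ => mul_comm _ _
  have huniq : ∀ (w : ι → ℝ) (r : ℝ), (∃ i ∈ σ, w i ≠ 0) → (∀ i ∈ σ, 0 ≤ w i) →
      (∀ i ∈ σ, ∑ j ∈ σ, A i j * w j = r * w i) → r = s := by
    intro w r hne h0 hw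
    have h1 := sum_pairing (w := w) hAy'
    rw [Finset.sum_congr rfl fun i hi => by rw [hw i hi]] at h1
    simp only [mul_left_comm _ r, ← Finset.mul_sum] at h1
    exact mul_right_cancel₀ (sum_pairing_pos hy h0 hne).ne' h1
  obtain ⟨i, hi⟩ := exists_mem_class hσ
  have hts : t = s := huniq x t ⟨i, hi, (hx i hi).ne'⟩ (fun j hj => (hx j hj).le) hAx
  have hroot : classRoot A σ = s := by
    have : distinguishedSpectrum
        (A.submatrix (fun i : {i // i ∈ σ} => (i : ι)) (fun i : {i // i ∈ σ} => (i : ι))) = {s} := by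
      ext r
      simp only [distinguishedSpectrum, Set.mem_ofPred_eq, isDistinguishedEigenvalue_submatrix,
        Set.mem_singleton_iff]
      refine ⟨fun ⟨_, w, h1, h2, h3⟩ => huniq w r h1 h2 h3, fun h => ?_⟩
      subst h
      exact ⟨hs, x, ⟨i, hi, (hx i hi).ne'⟩, fun j hj => (hx j hj).le, hts ▸ hAx⟩
    rw [classRoot, perronRoot, this, csSup_singleton]
  rw [hroot]
  exact ⟨hs, x, y, hx, hx', hy, hy', hts ▸ hAx, hAy'⟩

theorem classRoot_nonneg {ι : Type*} [Fintype ι] {A : Matrix ι ι ℝ} (hA : ∀ i j, 0 ≤ A i j)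
    {σ : Finset ι} (hσ : σ ∈ classes A) : 0 ≤ classRoot A σ :=
  (exists_perron_vectors hA hσ).1

theorem classRoot_eq {ι : Type*} [Fintype ι] {A : Matrix ι ι ℝ} (hA : ∀ i j, 0 ≤ A i j)
    {σ : Finset ι} (hσ : σ ∈ classes A) {w : ι → ℝ} {t : ℝ} (hne : ∃ i ∈ σ, w i ≠ 0)
    (h0 : ∀ i ∈ σ, 0 ≤ w i) (hw : ∀ i ∈ σ, ∑ j ∈ σ, A i j * w j = t * w i) :
    classRoot A σ = t := by
  obtain ⟨-, x, y, -, -, hy, -, -, hAy⟩ := exists_perron_vectors hA hσ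
  have h1 := sum_pairing (w := w) hAy
  rw [Finset.sum_congr rfl fun i hi => by rw [hw i hi]] at h1
  simp only [mul_left_comm _ t, ← Finset.mul_sum] at h1
  exact (mul_right_cancel₀ (sum_pairing_pos hy h0 hne).ne' h1).symm

/-- Pairing the inequality with the positive left Perron vector gives α yᵀw ≤ t yᵀw, and yᵀw > 0. -/
theorem classRoot_le {ι : Type*} [Fintype ι] {A : Matrix ι ι ℝ} (hA : ∀ i j, 0 ≤ A i j)
    {σ : Finset ι} (hσ : σ ∈ classes A) {w : ι → ℝ} {t : ℝ} (hne : ∃ i ∈ σ, w i ≠ 0)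
    (h0 : ∀ i ∈ σ, 0 ≤ w i) (hw : ∀ i ∈ σ, ∑ j ∈ σ, A i j * w j ≤ t * w i) :
    classRoot A σ ≤ t := by
  obtain ⟨-, x, y, -, -, hy, -, -, hAy⟩ := exists_perron_vectors hA hσ
  have h1 := sum_pairing (w := w) hAy
  have h2 : ∑ i ∈ σ, y i * ∑ j ∈ σ, A i j * w j ≤ ∑ i ∈ σ, y i * (t * w i) :=
    Finset.sum_le_sum fun i hi => mul_le_mul_of_nonneg_left (hw i hi) (hy i hi).le
  rw [h1] at h2
  simp only [mul_left_comm _ t, ← Finset.mul_sum] at h2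
  exact le_of_mul_le_mul_right h2 (sum_pairing_pos hy h0 hne)

/-- Access between classes is access between their elements. -/
theorem classAccess_iff {ι : Type*} [Fintype ι] {A : Matrix ι ι ℝ} {μ ν : Finset ι}
    (hμ : μ ∈ classes A) (hν : ν ∈ classes A) {i j : ι} (hi : i ∈ μ) (hj : j ∈ ν) :
    ClassAccess A μ ν ↔ Access A i j := by
  constructor
  · have edge : ∀ {μ ν : Finset ι}, ReducedEdge A μ ν → ∀ i ∈ μ, ∀ j ∈ ν, Access A i j := by
      rintro μ ν ⟨hμ, hν, a, ha, b, hb, hab⟩ i hi j hj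
      exact (((mem_class_iff hμ hi a).1 ha).1.trans (.single hab)).trans
        ((mem_class_iff hν hb j).1 hj).1
    rintro ⟨-, -, rfl | h⟩
    · exact ((mem_class_iff hμ hi j).1 hj).1
    · clear hν
      induction h generalizing j with
      | single h => exact edge h i hi j hj
      | tail _ h ih =>
        obtain ⟨k, hk⟩ := exists_mem_class h.1
        exact (ih hk).trans (edge h k hk j hj)
  · intro h
    have key : Relation.ReflTransGen (ReducedEdge A) μ ν := by
      induction h using Relation.ReflTransGen.head_induction_on generalizing μ with
      | refl => rw [class_eq_of_mem hμ hν hi hj]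
      | head hab _ ih =>
        rename_i a b _
        obtain ⟨τ, hτ, hb⟩ := exists_class A b
        exact .head ⟨hμ, hτ, a, hi, b, hb, hab⟩ (ih hτ hb)
    exact ⟨hμ, hν, (Relation.reflTransGen_iff_eq_or_transGen.1 key).imp_left Eq.symm⟩

/-! ### Access relations of commuting matrices -/

theorem Access.mono {ι : Type*} {A S : Matrix ι ι ℝ} (hAS : ∀ i j, A i j ≤ S i j) {i j : ι}
    (h : Access A i j) : Access S i j :=
  Relation.ReflTransGen.mono (fun a b hab => lt_of_lt_of_le hab (hAS a b)) i j h

/-- When no product passes through an index outside `σ`, taking the diagonal block is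
multiplicative, so commuting matrices have commuting blocks. -/
theorem trunc_mul {ι : Type*} [Fintype ι] [DecidableEq ι] {A B : Matrix ι ι ℝ} {σ : Finset ι}
    (h : ∀ i ∈ σ, ∀ j ∈ σ, ∀ k ∉ σ, A i k * B k j = 0) :
    trunc A σ * trunc B σ = trunc (A * B) σ := by
  ext i j
  simp only [mul_apply, trunc, of_apply]
  by_cases hij : i ∈ σ ∧ j ∈ σ
  · rw [if_pos hij]
    refine Finset.sum_congr rfl fun k _ => ?_
    by_cases hk : k ∈ σ
    · simp [hij, hk]
    · simp [hij, hk, h i hij.1 j hij.2 k hk]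
  · rw [if_neg hij]
    refine Finset.sum_eq_zero fun k _ => ?_
    by_cases hi : i ∈ σ
    · have hj : j ∉ σ := fun hj => hij ⟨hi, hj⟩
      simp [hj]
    · simp [hi]

/-- An index visited between two elements of a class lies in that class. -/
theorem mul_eq_zero_of_notMem_class {ι : Type*} {S A B : Matrix ι ι ℝ}
    (hA : ∀ i j, 0 ≤ A i j) (hB : ∀ i j, 0 ≤ B i j) (hAS : ∀ i j, 0 < A i j → Access S i j)
    (hBS : ∀ i j, 0 < B i j → Access S i j) {σ : Finset ι} (hσ : σ ∈ classes S) {i j k : ι}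
    (hi : i ∈ σ) (hj : j ∈ σ) (hk : k ∉ σ) : A i k * B k j = 0 := by
  by_contra h
  have h1 := lt_of_le_of_ne (hA i k) (Ne.symm (left_ne_zero_of_mul h))
  have h2 := lt_of_le_of_ne (hB k j) (Ne.symm (right_ne_zero_of_mul h))
  exact hk ((mem_class_iff hσ hi k).2
    ⟨hAS i k h1, (hBS k j h2).trans ((mem_class_iff hσ hi j).1 hj).2⟩)

/-- Commuting nonnegative matrices whose digraphs are contained in the access relation of `S` have
a common nonnegative eigenvector on each class of `S`. -/
theorem exists_common_class_vector {ι κ : Type*} [Fintype ι] [Finite κ] {S : Matrix ι ι ℝ}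
    {B : κ → Matrix ι ι ℝ} (hB : ∀ k i j, 0 ≤ B k i j) (hcomm : ∀ k l, B k * B l = B l * B k)
    (hBS : ∀ k i j, 0 < B k i j → Access S i j) {σ : Finset ι} (hσ : σ ∈ classes S) :
    ∃ w : ι → ℝ, (∀ i, 0 ≤ w i) ∧ (∀ i ∉ σ, w i = 0) ∧ (∃ i ∈ σ, w i ≠ 0) ∧
      ∃ t : κ → ℝ, ∀ k, ∀ i ∈ σ, ∑ j ∈ σ, B k i j * w j = t k * w i := by
  classical
  obtain ⟨w, hw, hne, hw0, t, ht⟩ := exists_common_eigenvector_mem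
    (B := fun k => trunc (B k) σ) (V := supportedIn σ)
    (fun k => trunc_nonneg (hB k) σ)
    (fun k l => by
      rw [trunc_mul (A := B k) (B := B l) fun i hi j hj m hm =>
          mul_eq_zero_of_notMem_class (hB k) (hB l) (hBS k) (hBS l) hσ hi hj hm,
        trunc_mul (A := B l) (B := B k) fun i hi j hj m hm =>
          mul_eq_zero_of_notMem_class (hB l) (hB k) (hBS l) (hBS k) hσ hi hj hm, hcomm])
    (fun k v _ => trunc_mulVec_mem (B k) σ v) (exists_supportedIn_nonneg (exists_mem_class hσ))
  refine ⟨w, hw0, hw, ?_, t, fun k i hi => ?_⟩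
  · obtain ⟨i, hi⟩ := Function.ne_iff.mp hne
    refine ⟨i, ?_, hi⟩
    by_contra h
    exact hi (hw i h)
  · have := congrFun (ht k).2 i
    rwa [trunc_mulVec, if_pos hi] at this

/-- If `A ≤ S` commute, then on every class of `S` the matrix `A` has a positive eigenvector. -/
theorem exists_pos_class_vector {ι : Type*} [Fintype ι] {A S : Matrix ι ι ℝ}
    (hA : ∀ i j, 0 ≤ A i j) (hAS : ∀ i j, A i j ≤ S i j) (hcomm : A * S = S * A)
    {σ : Finset ι} (hσ : σ ∈ classes S) :
    ∃ w : ι → ℝ, (∀ i ∈ σ, 0 < w i) ∧ ∃ t : ℝ, ∀ i ∈ σ, ∑ j ∈ σ, A i j * w j = t * w i := by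
  classical
  have hS : ∀ i j, 0 ≤ S i j := fun i j => (hA i j).trans (hAS i j)
  obtain ⟨w, hw0, hw, ⟨j, hj, hwj⟩, t, ht⟩ := exists_common_class_vector (S := S)
    (B := fun b : Bool => if b then A else S)
    (fun b i j => by cases b <;> simp [hA, hS])
    (fun a b => by cases a <;> cases b <;> simp [hcomm])
    (fun b i j h => by
      cases b
      · exact .single (by simpa using h)
      · exact .single (lt_of_lt_of_le (by simpa using h) (hAS i j))) hσ
  -- Positivity of the common eigenvector comes from `S`, which is irreducible on `σ`; nothing is
  -- known yet about the block of `A`.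
  have hSw : trunc S σ *ᵥ w = t false • w := by
    ext i
    rw [trunc_mulVec, Pi.smul_apply, smul_eq_mul]
    split_ifs with hi
    · simpa using ht false i hi
    · rw [hw i hi, mul_zero]
  exact ⟨w, fun i hi => pos_of_access (trunc_nonneg hS σ) hw0 hSw (access_trunc hσ hi hj)
    (lt_of_le_of_ne (hw0 j) hwj.symm), t true, fun i hi => by simpa using ht true i hi⟩

/-- If a nonnegative matrix has positive right and left eigenvectors on `μ`, then all its edges
inside `μ` are reversible. -/
theorem access_symm_of_pos_vectors {ι : Type*} {A : Matrix ι ι ℝ} (hA : ∀ i j, 0 ≤ A i j)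
    {μ : Finset ι} {y w : ι → ℝ} {s t : ℝ} (hy : ∀ i ∈ μ, 0 < y i) (hw : ∀ i ∈ μ, 0 < w i)
    (hAy : ∀ j ∈ μ, ∑ i ∈ μ, y i * A i j = s * y j)
    (hAw : ∀ i ∈ μ, ∑ j ∈ μ, A i j * w j = t * w i) {i j : ι} (hi : i ∈ μ) (hj : j ∈ μ)
    (hij : 0 < A i j) : Access A j i := by
  classical
  have hst : t = s := by
    have h1 := sum_pairing (w := w) hAy
    rw [Finset.sum_congr rfl fun i hi => by rw [hAw i hi]] at h1
    simp only [mul_left_comm _ t, ← Finset.mul_sum] at h1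
    exact mul_right_cancel₀
      (sum_pairing_pos hy (fun i hi => (hw i hi).le) ⟨i, hi, (hw i hi).ne'⟩).ne' h1
  subst hst
  by_contra hji
  -- Since no edge of `A` within `μ` leaves `D`, the right eigenvector evaluates the weight ∑ yₐ Aₐᵦ
  -- wᵦ over D × D, and the left one evaluates it over μ × D. Both give the same value, so no edge
  -- enters `D` from the rest of `μ`; but (i, j) would be one.
  set D := μ.filter fun k => Access A j k with hD
  have hDμ : D ⊆ μ := Finset.filter_subset _ _
  have hjD : j ∈ D := Finset.mem_filter.2 ⟨hj, .refl j⟩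
  have hiD : i ∉ D := fun h => hji (Finset.mem_filter.1 h).2
  have h1 : ∑ b ∈ D, ∑ a ∈ μ, y a * A a b * w b = t * ∑ b ∈ D, y b * w b := by
    rw [Finset.mul_sum]
    refine Finset.sum_congr rfl fun b hb => ?_
    rw [← Finset.sum_mul, hAy b (hDμ hb), mul_assoc]
  have h2 : ∑ b ∈ D, ∑ a ∈ D, y a * A a b * w b = t * ∑ b ∈ D, y b * w b := by
    rw [Finset.sum_comm, Finset.mul_sum]
    refine Finset.sum_congr rfl fun a ha => ?_
    have : ∑ b ∈ D, A a b * w b = t * w a := by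
      rw [← hAw a (hDμ ha)]
      refine Finset.sum_subset hDμ fun b hb hbD => ?_
      rw [le_antisymm (not_lt.1 fun h => hbD (Finset.mem_filter.2
        ⟨hb, (Finset.mem_filter.1 ha).2.trans (.single h)⟩)) (hA a b), zero_mul]
    simp only [mul_assoc, ← Finset.mul_sum, this]
    ring
  have hnn : ∀ a ∈ μ, ∀ b ∈ μ, 0 ≤ y a * A a b * w b := fun a ha b hb =>
    mul_nonneg (mul_nonneg (hy a ha).le (hA a b)) (hw b hb).le
  have h3 : ∑ b ∈ D, ∑ a ∈ D, y a * A a b * w b < ∑ b ∈ D, ∑ a ∈ μ, y a * A a b * w b := by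
    refine Finset.sum_lt_sum (fun b hb => Finset.sum_le_sum_of_subset_of_nonneg hDμ
      fun a ha _ => hnn a ha b (hDμ hb)) ⟨j, hjD, ?_⟩
    exact Finset.sum_lt_sum_of_subset hDμ hi hiD
      (mul_pos (mul_pos (hy i hi) hij) (hw j hj)) fun a ha _ => hnn a ha j hj
  rw [h1, h2] at h3
  exact lt_irrefl _ h3

/-- Two indices in the same class of `S` are in the same class of `A`, if `A ≤ S` commute and
distinct classes of `A` have distinct Perron roots. -/
theorem access_of_mem_class {ι : Type*} [Fintype ι] {A S : Matrix ι ι ℝ}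
    (hA : ∀ i j, 0 ≤ A i j) (hAS : ∀ i j, A i j ≤ S i j) (hcomm : A * S = S * A)
    (hinj : Set.InjOn (classRoot A) (classes A)) {μ : Finset ι} (hμ : μ ∈ classes S) {i j : ι}
    (hi : i ∈ μ) (hj : j ∈ μ) : Access A i j := by
  have hle : ∀ {i j}, Access A i j → Access S i j := Access.mono hAS
  obtain ⟨w, hw, t, hAw⟩ := exists_pos_class_vector hA hAS hcomm hμ
  obtain ⟨y, hy, s, hAy⟩ := exists_pos_class_vector (A := Aᵀ) (S := Sᵀ) (σ := μ)
    (fun i j => hA j i) (fun i j => hAS j i)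
    (by rw [← transpose_mul, ← transpose_mul, hcomm]) (by rwa [classes_transpose])
  have hAy' : ∀ j ∈ μ, ∑ i ∈ μ, y i * A i j = s * y j := fun j hj => by
    rw [← hAy j hj]
    exact Finset.sum_congr rfl fun i _ => mul_comm _ _
  -- Edges of `A` inside `μ` are reversible, hence do not leave `σ`, so `w` restricted to `σ` is
  -- still an eigenvector for the same `t`.
  have hroot : ∀ σ ∈ classes A, ∀ a ∈ σ, a ∈ μ → classRoot A σ = t := by
    intro σ hσ a ha haμ
    have hsub : σ ⊆ μ := fun b hb => by
      have := (mem_class_iff hσ ha b).1 hb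
      exact (mem_class_iff hμ haμ b).2 ⟨hle this.1, hle this.2⟩
    refine classRoot_eq hA hσ (w := w) ⟨a, ha, (hw a haμ).ne'⟩ (fun b hb => (hw b (hsub hb)).le)
      fun b hb => ?_
    rw [← hAw b (hsub hb)]
    refine Finset.sum_subset hsub fun c hc hcσ => ?_
    rw [le_antisymm (not_lt.1 fun h => hcσ ((mem_class_iff hσ hb c).2 ⟨.single h,
      access_symm_of_pos_vectors hA hy hw hAy' hAw (hsub hb) hc h⟩)) (hA b c), zero_mul]
  obtain ⟨σ, hσ, hiσ⟩ := exists_class A i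
  obtain ⟨τ, hτ, hjτ⟩ := exists_class A j
  have : σ = τ := hinj hσ hτ ((hroot σ hσ i hiσ hi).trans (hroot τ hτ j hjτ hj).symm)
  subst this
  exact ((mem_class_iff hσ hiσ j).1 hjτ).1

theorem exists_edge_leaving {ι : Type*} {S : Matrix ι ι ℝ} {i j : ι} (h : Access S i j)
    {X : Set ι} (hi : i ∈ X) (hj : j ∉ X) :
    ∃ a ∈ X, ∃ b ∉ X, 0 < S a b ∧ Access S i a ∧ Access S b j := by
  induction h using Relation.ReflTransGen.head_induction_on with
  | refl => exact absurd hi hj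
  | head hab hbj ih =>
    rename_i a b
    by_cases hb : b ∈ X
    · obtain ⟨c, hc, d, hd, hcd, h1, h2⟩ := ih hb
      exact ⟨c, hc, d, hd, hcd, Access.trans (.single hab) h1, h2⟩
    · exact ⟨a, hi, b, hb, hab, .refl a, hbj⟩

/-- If `A` and `S` commute and two classes `μ`, `ν` of both matrices with different Perron roots
with respect to `A` are joined by an edge of `S` but by no path of `S` through a third class, then
they are joined by an edge of `A`. -/
theorem exists_edge_of_covering {ι : Type*} [Fintype ι] {A S : Matrix ι ι ℝ}
    (hA : ∀ i j, 0 ≤ A i j) (hAS : ∀ i j, A i j ≤ S i j) (hcomm : A * S = S * A)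
    {μ ν : Finset ι} (hμ : μ ∈ classes A) (hν : ν ∈ classes A)
    (hroot : classRoot A μ ≠ classRoot A ν)
    (hbetween : ∀ i ∈ μ, ∀ j ∈ ν, ∀ k, 0 < S i k → 0 < S k j → k ∈ μ ∨ k ∈ ν)
    {a b : ι} (ha : a ∈ μ) (hb : b ∈ ν) (hab : 0 < S a b) : ∃ i ∈ μ, ∃ j ∈ ν, 0 < A i j := by
  classical
  by_contra! hno
  have hS : ∀ i j, 0 ≤ S i j := fun i j => (hA i j).trans (hAS i j)
  have hno' : ∀ i ∈ μ, ∀ j ∈ ν, A i j = 0 := fun i hi j hj => le_antisymm (hno i hi j hj) (hA i j)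
  obtain ⟨-, -, y, -, -, hy, hy', -, hAy⟩ := exists_perron_vectors hA hμ
  obtain ⟨-, x, -, hx, hx', -, -, hAx, -⟩ := exists_perron_vectors hA hν
  have hy0 : ∀ i, 0 ≤ y i := fun i => by
    by_cases hi : i ∈ μ
    · exact (hy i hi).le
    · rw [hy' i hi]
  have hx0 : ∀ i, 0 ≤ x i := fun i => by
    by_cases hi : i ∈ ν
    · exact (hx i hi).le
    · rw [hx' i hi]
  have hdisj : ∀ k ∈ μ, k ∉ ν := fun k hk hk' => hroot (by rw [class_eq_of_mem hμ hν hk hk'])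
  have hzero : ∀ i ∈ μ, ∀ j ∈ ν, ∀ k, k ∉ μ → k ∉ ν → S i k = 0 ∨ S k j = 0 := by
    intro i hi j hj k hkμ hkν
    by_contra! h
    rcases hbetween i hi j hj k (lt_of_le_of_ne (hS i k) h.1.symm)
      (lt_of_le_of_ne (hS k j) h.2.symm) with h | h <;> contradiction
  have hAzero : ∀ i j, S i j = 0 → A i j = 0 := fun i j h => le_antisymm (h ▸ hAS i j) (hA i j)
  -- Without edges of `A` from μ to ν and without third classes in between, the (μ, ν) blocks of AS
  -- and SA reduce to A_μμ S_μν and S_μν A_νν.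
  have e1 : ∀ i ∈ μ, ∀ j ∈ ν, (A * S) i j = ∑ k ∈ μ, A i k * S k j := by
    intro i hi j hj
    rw [mul_apply]
    refine (Finset.sum_subset (Finset.subset_univ μ) fun k _ hk => ?_).symm
    by_cases hkν : k ∈ ν
    · rw [hno' i hi k hkν, zero_mul]
    · rcases hzero i hi j hj k hk hkν with h | h
      · rw [hAzero _ _ h, zero_mul]
      · rw [h, mul_zero]
  have e2 : ∀ i ∈ μ, ∀ j ∈ ν, (S * A) i j = ∑ k ∈ ν, S i k * A k j := by
    intro i hi j hj
    rw [mul_apply]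
    refine (Finset.sum_subset (Finset.subset_univ ν) fun k _ hk => ?_).symm
    by_cases hkμ : k ∈ μ
    · rw [hno' k hkμ j hj, mul_zero]
    · rcases hzero i hi j hj k hkμ hk with h | h
      · rw [h, zero_mul]
      · rw [hAzero _ _ h, mul_zero]
  set Q := ∑ i ∈ μ, ∑ j ∈ ν, y i * S i j * x j with hQ
  have hnn : ∀ i j, 0 ≤ y i * S i j * x j := fun i j =>
    mul_nonneg (mul_nonneg (hy0 i) (hS i j)) (hx0 j)
  have hQpos : 0 < Q := Finset.sum_pos' (fun i _ => Finset.sum_nonneg fun j _ => hnn i j)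
    ⟨a, ha, Finset.sum_pos' (fun j _ => hnn a j)
      ⟨b, hb, mul_pos (mul_pos (hy a ha) hab) (hx b hb)⟩⟩
  have q1 : ∑ i ∈ μ, ∑ j ∈ ν, y i * (A * S) i j * x j = classRoot A μ * Q := by
    calc _ = ∑ i ∈ μ, ∑ j ∈ ν, ∑ k ∈ μ, y i * A i k * (S k j * x j) := by
            refine Finset.sum_congr rfl fun i hi => Finset.sum_congr rfl fun j hj => ?_
            rw [e1 i hi j hj, Finset.mul_sum, Finset.sum_mul]
            exact Finset.sum_congr rfl fun k _ => by ring
      _ = ∑ j ∈ ν, ∑ k ∈ μ, ∑ i ∈ μ, y i * A i k * (S k j * x j) := by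
            rw [Finset.sum_comm]
            exact Finset.sum_congr rfl fun j _ => Finset.sum_comm
      _ = ∑ j ∈ ν, ∑ k ∈ μ, classRoot A μ * (y k * S k j * x j) := by
            refine Finset.sum_congr rfl fun j _ => Finset.sum_congr rfl fun k hk => ?_
            rw [← Finset.sum_mul, hAy k hk]
            ring
      _ = _ := by
            rw [Finset.sum_comm]
            simp only [hQ, Finset.mul_sum]
  have q2 : ∑ i ∈ μ, ∑ j ∈ ν, y i * (S * A) i j * x j = classRoot A ν * Q := by
    rw [hQ, Finset.mul_sum]
    refine Finset.sum_congr rfl fun i hi => ?_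
    calc _ = ∑ j ∈ ν, ∑ k ∈ ν, y i * S i k * (A k j * x j) := by
            refine Finset.sum_congr rfl fun j hj => ?_
            rw [e2 i hi j hj, Finset.mul_sum, Finset.sum_mul]
            exact Finset.sum_congr rfl fun k _ => by ring
      _ = ∑ k ∈ ν, y i * S i k * ∑ j ∈ ν, A k j * x j := by
            rw [Finset.sum_comm]
            simp only [Finset.mul_sum]
      _ = _ := by
            rw [Finset.mul_sum]
            refine Finset.sum_congr rfl fun k hk => ?_
            rw [hAx k hk]
            ring
  rw [hcomm, q2] at q1
  exact hroot (mul_right_cancel₀ hQpos.ne' q1).symm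

/-- If `A ≤ S` are commuting nonnegative matrices and distinct classes of `A` have distinct Perron
roots, then `A` and `S` have the same access relation. -/
theorem access_iff_of_le {ι : Type*} [Fintype ι] {A S : Matrix ι ι ℝ}
    (hA : ∀ i j, 0 ≤ A i j) (hAS : ∀ i j, A i j ≤ S i j) (hcomm : A * S = S * A)
    (hinj : Set.InjOn (classRoot A) (classes A)) (i j : ι) : Access A i j ↔ Access S i j := by
  classical
  refine ⟨Access.mono hAS, ?_⟩
  have hsame : ∀ {a b}, Access S a b → Access S b a → Access A a b := by
    intro a b hab hba
    obtain ⟨μ, hμ, ha⟩ := exists_class S a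
    exact access_of_mem_class hA hAS hcomm hinj hμ ha ((mem_class_iff hμ ha b).2 ⟨hab, hba⟩)
  have hle : ∀ {i j}, Access A i j → Access S i j := Access.mono hAS
  -- Induction on the size of the interval between `i` and `j` in the access preorder of `S`; an
  -- index strictly between them splits it into two smaller intervals.
  induction hN : (Finset.univ.filter fun k => Access S i k ∧ Access S k j).card
    using Nat.strong_induction_on generalizing i j with
  | _ N ih =>
  intro hij
  subst hN
  by_cases hji : Access S j i
  · exact hsame hij hji
  by_cases hmid : ∃ k, Access S i k ∧ Access S k j ∧ ¬ Access S k i ∧ ¬ Access S j k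
  · obtain ⟨k, hik, hkj, hki, hjk⟩ := hmid
    refine Access.trans (ih _ (Finset.card_lt_card ?_) i k rfl hik)
      (ih _ (Finset.card_lt_card ?_) k j rfl hkj)
    · refine Finset.ssubset_iff_subset_ne.2 ⟨fun l => ?_, fun h => ?_⟩
      · simp only [Finset.mem_filter, Finset.mem_univ, true_and]
        exact fun h => ⟨h.1, h.2.trans hkj⟩
      · have : j ∈ Finset.univ.filter fun l => Access S i l ∧ Access S l k := by
          rw [h]
          simpa using ⟨hij, .refl j⟩
        exact hjk (by simpa using (Finset.mem_filter.1 this).2.2)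
    · refine Finset.ssubset_iff_subset_ne.2 ⟨fun l => ?_, fun h => ?_⟩
      · simp only [Finset.mem_filter, Finset.mem_univ, true_and]
        exact fun h => ⟨hik.trans h.1, h.2⟩
      · have : i ∈ Finset.univ.filter fun l => Access S k l ∧ Access S l j := by
          rw [h]
          simpa using ⟨.refl i, hij⟩
        exact hki (by simpa using (Finset.mem_filter.1 this).2.1)
  · push Not at hmid
    obtain ⟨μ, hμ, hiμ⟩ := exists_class A i
    obtain ⟨ν, hν, hjν⟩ := exists_class A j
    have hmem : ∀ {a b : ι} {σ : Finset ι}, σ ∈ classes A → a ∈ σ →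
        (b ∈ σ ↔ Access S a b ∧ Access S b a) := fun hσ ha => by
      rw [mem_class_iff hσ ha]
      exact ⟨fun h => ⟨hle h.1, hle h.2⟩, fun h => ⟨hsame h.1 h.2, hsame h.2 h.1⟩⟩
    have hμν : μ ≠ ν := by
      rintro rfl
      exact hji ((hmem hμ hiμ).1 hjν).2
    have hbtw : ∀ k, Access S i k → Access S k j → k ∈ μ ∨ k ∈ ν := by
      intro k h1 h2
      by_cases hki : Access S k i
      · exact Or.inl ((hmem hμ hiμ).2 ⟨h1, hki⟩)
      · exact Or.inr ((hmem hν hjν).2 ⟨hmid k h1 h2 hki, h2⟩)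
    -- With nothing strictly between, the edge on which a path of `S` leaves `μ` lands in `ν`.
    obtain ⟨a, ha, b, hb, hab, -, hbj⟩ := exists_edge_leaving hij (X := (μ : Set ι)) hiμ
      (fun h => hji ((hmem hμ hiμ).1 h).2)
    have hbν : b ∈ ν :=
      (hbtw b (((hmem hμ hiμ).1 ha).1.trans (.single hab)) hbj).resolve_left hb
    obtain ⟨c, hc, d, hd, hcd⟩ := exists_edge_of_covering hA hAS hcomm hμ hν
      (fun h => hμν (hinj hμ hν h))
      (fun p hp q hq k hpk hkq => hbtw k (((hmem hμ hiμ).1 hp).1.trans (.single hpk))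
        (Access.trans (.single hkq) ((hmem hν hjν).1 hq).2)) ha hbν hab
    exact ((hsame ((hmem hμ hiμ).1 hc).1 ((hmem hμ hiμ).1 hc).2).trans (.single hcd)).trans
      (hsame ((hmem hν hjν).1 hd).2 ((hmem hν hjν).1 hd).1)

/-! ### Premier spectral classes and nonnegative eigenvectors -/

/-- The strict inequality already implies spectrality: roots are nonnegative, so a class with root 0
that dominates strictly must be initial. -/
theorem isPremierSpectralClass_iff {ι : Type*} [Fintype ι] {A : Matrix ι ι ℝ}
    (hA : ∀ i j, 0 ≤ A i j) {ν : Finset ι} : IsPremierSpectralClass A ν ↔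
      ν ∈ classes A ∧ ∀ μ, ClassAccess A μ ν → μ ≠ ν → classRoot A μ < classRoot A ν := by
  refine ⟨fun h => ⟨h.1.1, h.2⟩, fun h => ⟨⟨h.1, ?_⟩, h.2⟩⟩
  rcases (classRoot_nonneg hA h.1).eq_or_lt with h0 | h0
  · refine Or.inl ⟨h.1, fun μ hμ => ?_⟩
    by_contra hne
    have h1 := h.2 μ hμ hne
    have h2 := classRoot_nonneg hA hμ.1
    linarith
  · refine Or.inr ⟨h0, fun μ hμ => ?_⟩
    by_cases hne : μ = ν
    · rw [hne]
    · exact (h.2 μ hμ hne).le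

open Classical in
/-- The number of indices to which `i` has access. -/
noncomputable def accessCard {ι : Type*} [Fintype ι] (A : Matrix ι ι ℝ) (i : ι) : ℕ :=
  (Finset.univ.filter fun j => Access A i j).card

theorem accessCard_le {ι : Type*} [Fintype ι] {A : Matrix ι ι ℝ} {i j : ι}
    (h : Access A i j) : accessCard A j ≤ accessCard A i := by
  refine Finset.card_le_card fun k => ?_
  simp only [Finset.mem_filter, Finset.mem_univ, true_and]
  exact h.trans

/-- Thus `accessCard` ranks the classes: its minimizers on a support lie in final classes, and its
strict drop between classes controls the weights used in gluing. -/
theorem accessCard_lt {ι : Type*} [Fintype ι] {A : Matrix ι ι ℝ} {i j : ι}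
    (h : Access A i j) (h' : ¬ Access A j i) : accessCard A j < accessCard A i := by
  classical
  refine Finset.card_lt_card (Finset.ssubset_iff_subset_ne.2 ⟨fun k => ?_, fun he => h' ?_⟩)
  · simp only [Finset.mem_filter, Finset.mem_univ, true_and]
    exact h.trans
  · have : i ∈ Finset.univ.filter fun k => Access A j k := by
      rw [he]
      simpa using Access.refl i
    simpa using this

theorem sum_class_le_mulVec {ι : Type*} [Fintype ι] {A : Matrix ι ι ℝ} (hA : ∀ i j, 0 ≤ A i j)
    {w : ι → ℝ} (hw : ∀ i, 0 ≤ w i) (σ : Finset ι) (i : ι) :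
    ∑ j ∈ σ, A i j * w j ≤ (A *ᵥ w) i :=
  Finset.sum_le_sum_of_subset_of_nonneg (Finset.subset_univ σ)
    fun j _ _ => mul_nonneg (hA i j) (hw j)

/-- The final class in the support of a nonnegative eigenvector is premier spectral. -/
theorem premier_of_final_class {ι : Type*} [Fintype ι] {A : Matrix ι ι ℝ}
    (hA : ∀ i j, 0 ≤ A i j) (hinj : Set.InjOn (classRoot A) (classes A)) {w : ι → ℝ}
    (hw : ∀ i, 0 ≤ w i) {t : ℝ} (hAw : A *ᵥ w = t • w) {ν : Finset ι} (hν : ν ∈ classes A)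
    (hne : ∃ i ∈ ν, w i ≠ 0)
    (hfinal : ∀ i ∈ ν, ∀ j ∉ ν, Access A i j → w j = 0) :
    classRoot A ν = t ∧ IsPremierSpectralClass A ν := by
  have hAw' : ∀ i, (A *ᵥ w) i = t * w i := fun i => congrFun hAw i
  have hroot : classRoot A ν = t := by
    refine classRoot_eq hA hν hne (fun i _ => hw i) fun i hi => ?_
    rw [← hAw' i]
    refine Finset.sum_subset (Finset.subset_univ ν) fun j _ hj => ?_
    rcases (hA i j).eq_or_lt with h | h
    · rw [← h, zero_mul]
    · rw [hfinal i hi j hj (.single h), mul_zero]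
  refine ⟨hroot, (isPremierSpectralClass_iff hA).2 ⟨hν, fun μ hμν hμ => ?_⟩⟩
  obtain ⟨j, hj, hwj⟩ := hne
  obtain ⟨i, hi⟩ := exists_mem_class hμν.1
  have hij := (classAccess_iff hμν.1 hν hi hj).1 hμν
  -- Subinvariance of `w` on `μ` gives only ≤; strictness is due to the distinctness of the roots.
  refine lt_of_le_of_ne ?_ fun h => hμ (hinj hμν.1 hν h)
  rw [hroot]
  refine classRoot_le hA hμν.1 (w := w) ⟨i, hi, ?_⟩ (fun i _ => hw i) fun k _ => ?_
  · exact (pos_of_access hA hw hAw hij (lt_of_le_of_ne (hw j) hwj.symm)).ne'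
  · rw [← hAw' k]
    exact sum_class_le_mulVec hA hw μ k

theorem classes_congr {ι : Type*} {A B : Matrix ι ι ℝ}
    (h : ∀ i j, Access A i j ↔ Access B i j) : classes A = classes B := by
  ext μ
  simp only [classes, Set.mem_ofPred_eq, h]

theorem classAccess_congr {ι : Type*} [Fintype ι] {A B : Matrix ι ι ℝ}
    (h : ∀ i j, Access A i j ↔ Access B i j) (μ ν : Finset ι) :
    ClassAccess A μ ν ↔ ClassAccess B μ ν := by
  have hc := classes_congr h
  by_cases hμ : μ ∈ classes A
  · by_cases hν : ν ∈ classes A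
    · obtain ⟨i, hi⟩ := exists_mem_class hμ
      obtain ⟨j, hj⟩ := exists_mem_class hν
      rw [classAccess_iff hμ hν hi hj, classAccess_iff (hc ▸ hμ) (hc ▸ hν) hi hj, h]
    · exact ⟨fun h => absurd h.2.1 hν, fun h => absurd (hc ▸ h.2.1) hν⟩
  · exact ⟨fun h => absurd h.1 hμ, fun h => absurd (hc ▸ h.1) hμ⟩

/-- The eigenvalues of a common nonnegative eigenvector are the Perron roots of a common premier
spectral class. -/
theorem exists_premier_of_common_eigenvector {ι κ : Type*} [Fintype ι] {S : Matrix ι ι ℝ}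
    {A : κ → Matrix ι ι ℝ} (hA : ∀ k i j, 0 ≤ A k i j)
    (hinj : ∀ k, Set.InjOn (classRoot (A k)) (classes (A k)))
    (hacc : ∀ k i j, Access (A k) i j ↔ Access S i j) {w : ι → ℝ} (hne : w ≠ 0)
    (hw : ∀ i, 0 ≤ w i) {t : κ → ℝ} (hAw : ∀ k, A k *ᵥ w = t k • w) :
    ∃ ν, ∀ k, classRoot (A k) ν = t k ∧ IsPremierSpectralClass (A k) ν := by
  classical
  obtain ⟨i₀, hi₀⟩ := Function.ne_iff.mp hne
  obtain ⟨i, hi, hmin⟩ := (Finset.univ.filter fun i => w i ≠ 0).exists_min_image (accessCard S)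
    ⟨i₀, by simpa using hi₀⟩
  simp only [Finset.mem_filter, Finset.mem_univ, true_and] at hi hmin
  obtain ⟨ν, hν, hiν⟩ := exists_class S i
  refine ⟨ν, fun k => ?_⟩
  have hνk : ν ∈ classes (A k) := by rwa [classes_congr (hacc k)]
  refine premier_of_final_class (hA k) (hinj k) hw (hAw k) hνk ⟨i, hiν, hi⟩
    fun a ha b hb hab => ?_
  by_contra hwb
  rw [hacc] at hab
  have hia := (mem_class_iff hν hiν a).1 ha
  have hib := hia.1.trans hab
  exact (accessCard_lt hib fun hbi => hb ((mem_class_iff hν hiν b).2 ⟨hib, hbi⟩)).not_ge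
    (hmin b hwb)

/-- A nonnegative vector with `A u ≤ t u`, where equality holds on a set `ν` whose out-neighbours
outside `ν` are not in the support of `u`, can be decreased outside `ν` to an eigenvector. -/
theorem exists_eigenvector_of_mulVec_le {ι : Type*} [Fintype ι] {A : Matrix ι ι ℝ}
    (hA : ∀ i j, 0 ≤ A i j) {u : ι → ℝ} (hu : ∀ i, 0 ≤ u i) {t : ℝ} (ht : 0 < t)
    (hAu : ∀ i, (A *ᵥ u) i ≤ t * u i) {ν : Finset ι} (hν : ∀ i ∈ ν, (A *ᵥ u) i = t * u i)
    (hout : ∀ i ∈ ν, ∀ j ∉ ν, 0 < A i j → u j = 0) :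
    ∃ w : ι → ℝ, (∀ i, 0 ≤ w i) ∧ (∀ i ∈ ν, w i = u i) ∧ A *ᵥ w = t • w := by
  -- The iterates of t⁻¹A decrease from the supersolution `u`, stay nonnegative and are constant on
  -- `ν`; their limit is a fixed point.
  let f : (ι → ℝ) → ι → ℝ := fun w => t⁻¹ • A *ᵥ w
  have hmono : Monotone f := fun v w hvw i => mul_le_mul_of_nonneg_left
    (Finset.sum_le_sum fun j _ => mul_le_mul_of_nonneg_left (hvw j) (hA i j)) (inv_nonneg.2 ht.le)
  have hfu : f u ≤ u := fun i => by
    simp only [f, Pi.smul_apply, smul_eq_mul]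
    rw [inv_mul_le_iff₀ ht]
    exact hAu i
  have hanti := hmono.antitone_iterate_of_map_le hfu
  have hnn : ∀ m i, 0 ≤ f^[m] u i := by
    intro m
    induction m with
    | zero => exact hu
    | succ m ih =>
      intro i
      rw [Function.iterate_succ_apply']
      exact mul_nonneg (inv_nonneg.2 ht.le) (mulVec_nonneg hA ih i)
  have heq : ∀ m, ∀ i ∈ ν, f^[m] u i = u i := by
    intro m
    induction m with
    | zero => exact fun _ _ => rfl
    | succ m ih =>
      intro i hi
      rw [Function.iterate_succ_apply']
      have : (A *ᵥ f^[m] u) i = (A *ᵥ u) i := by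
        refine Finset.sum_congr rfl fun j _ => ?_
        by_cases hj : j ∈ ν
        · rw [ih j hj]
        · rcases (hA i j).eq_or_lt with h | h
          · simp only [← h, zero_mul]
          · have h1 := hout i hi j hj h
            have h2 : f^[m] u j ≤ u j := hanti (Nat.zero_le m) j
            rw [h1, le_antisymm (h1 ▸ h2) (hnn m j)]
      simp only [f, Pi.smul_apply, smul_eq_mul]
      rw [this, hν i hi, inv_mul_cancel_left₀ ht.ne']
  have hlim : Filter.Tendsto (fun m => f^[m] u) Filter.atTop
      (nhds fun i => ⨅ m, f^[m] u i) := by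
    rw [tendsto_pi_nhds]
    intro i
    refine tendsto_atTop_ciInf (fun a b hab => hanti hab i) ⟨0, ?_⟩
    rintro _ ⟨m, rfl⟩
    exact hnn m i
  have hf : Continuous f := by
    simp only [f]
    fun_prop
  have hfix := isFixedPt_of_tendsto_iterate hlim hf.continuousAt
  refine ⟨_, fun i => Real.iInf_nonneg fun m => hnn m i, fun i hi => ?_, ?_⟩
  · simp [heq _ i hi]
  · have h : t⁻¹ • A *ᵥ (fun i => ⨅ m, f^[m] u i) = fun i => ⨅ m, f^[m] u i := hfix
    rw [inv_smul_eq_iff₀ ht.ne'] at h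
    exact h

/-- The Perron root of a premier spectral class is a distinguished eigenvalue. -/
theorem distinguished_of_premier {ι : Type*} [Fintype ι] {A : Matrix ι ι ℝ}
    (hA : ∀ i j, 0 ≤ A i j) {ν : Finset ι} (hpr : IsPremierSpectralClass A ν) :
    classRoot A ν ∈ distinguishedSpectrum A := by
  classical
  obtain ⟨hν, hlt⟩ := (isPremierSpectralClass_iff hA).1 hpr
  obtain ⟨j₀, hj₀⟩ := exists_mem_class hν
  choose cl hcl hmem using exists_class A
  have hcl_eq : ∀ {i j}, j ∈ cl i → cl j = cl i := fun h =>
    class_eq_of_mem (hcl _) (hcl _) (hmem _) h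
  have hperron : ∀ σ : Finset ι, ∃ x : ι → ℝ, σ ∈ classes A → (∀ i ∈ σ, 0 < x i) ∧
      ∀ i ∈ σ, ∑ j ∈ σ, A i j * x j = classRoot A σ * x i := by
    intro σ
    by_cases hσ : σ ∈ classes A
    · obtain ⟨-, x, -, hx, -, -, -, hAx, -⟩ := exists_perron_vectors hA hσ
      exact ⟨x, fun _ => ⟨hx, hAx⟩⟩
    · exact ⟨0, fun h => absurd h hσ⟩
  choose x hx using hperron
  set X : ι → ℝ := fun i => x (cl i) i with hX
  have hXpos : ∀ i, 0 < X i := fun i => (hx _ (hcl i)).1 i (hmem i)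
  have hAX : ∀ i, ∑ j ∈ cl i, A i j * X j = classRoot A (cl i) * X i := by
    intro i
    rw [hX, ← (hx _ (hcl i)).2 i (hmem i)]
    refine Finset.sum_congr rfl fun j hj => ?_
    simp only [hcl_eq hj]
  set t := classRoot A ν with ht
  have ht0 : 0 ≤ t := classRoot_nonneg hA hν
  have hlt' : ∀ i, Access A i j₀ → i ∉ ν → classRoot A (cl i) < t := fun i hi hiν =>
    hlt (cl i) ((classAccess_iff (hcl i) hν (hmem i) hj₀).2 hi) fun h => hiν (h ▸ hmem i)
  -- One constant at least 1 and above every ratio needed in `hMi`. Absolute values are taken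
  -- because for the other indices the ratio may be negative.
  set M : ℝ := 1 + ∑ i, |(∑ j, A i j * X j) / ((t - classRoot A (cl i)) * X i)| with hM
  have hM1 : 1 ≤ M := le_add_of_nonneg_right (Finset.sum_nonneg fun i _ => abs_nonneg _)
  have hM0 : 0 < M := by linarith
  have hMi : ∀ i, Access A i j₀ → i ∉ ν →
      ∑ j, A i j * X j ≤ M * ((t - classRoot A (cl i)) * X i) := by
    intro i hi hiν
    rw [← div_le_iff₀ (mul_pos (sub_pos.2 (hlt' i hi hiν)) (hXpos i))]
    refine (le_abs_self _).trans ?_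
    have := Finset.single_le_sum
      (f := fun i => |(∑ j, A i j * X j) / ((t - classRoot A (cl i)) * X i)|)
      (fun i _ => abs_nonneg _) (Finset.mem_univ i)
    linarith
  -- The Perron vectors of the classes with access to `ν` are glued with weights constant on
  -- classes. An edge to another class loses at least one factor `M`, so the inflow from other
  -- classes is absorbed by the gap t - α of the row's class, giving Au ≤ tu.
  set u : ι → ℝ := fun i => if Access A i j₀ then M ^ accessCard A i * X i else 0 with hu
  have hu0 : ∀ i, 0 ≤ u i := fun i => by
    simp only [hu]
    split_ifs
    · exact (mul_pos (pow_pos hM0 _) (hXpos i)).le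
    · exact le_rfl
  have hsplit : ∀ i, Access A i j₀ →
      (A *ᵥ u) i = classRoot A (cl i) * u i + ∑ j ∈ (cl i)ᶜ, A i j * u j := by
    intro i hi
    have h1 : ∑ j ∈ cl i, A i j * u j = classRoot A (cl i) * u i := by
      have h2 : ∀ j ∈ cl i, A i j * u j = M ^ accessCard A i * (A i j * X j) := by
        intro j hj
        have hij := (mem_class_iff (hcl i) (hmem i) j).1 hj
        simp only [hu]
        rw [if_pos (hij.2.trans hi),
          le_antisymm (accessCard_le hij.1) (accessCard_le hij.2)]
        ring
      rw [Finset.sum_congr rfl h2, ← Finset.mul_sum, hAX]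
      simp only [hu]
      rw [if_pos hi]
      ring
    rw [← h1, Finset.sum_add_sum_compl]
    rfl
  have hclν : ∀ i ∈ ν, cl i = ν := fun i hi => class_eq_of_mem (hcl i) hν (hmem i) hi
  have hout : ∀ i ∈ ν, ∀ j ∉ ν, 0 < A i j → u j = 0 := by
    intro i hi j hj hij
    simp only [hu]
    rw [if_neg]
    intro h
    have := (mem_class_iff hν hj₀ i).1 hi
    exact hj ((mem_class_iff hν hj₀ j).2 ⟨this.1.trans (.single hij), h⟩)
  have hon : ∀ i ∈ ν, (A *ᵥ u) i = t * u i := by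
    intro i hi
    rw [hsplit i ((mem_class_iff hν hi j₀).1 hj₀).1, hclν i hi, Finset.sum_eq_zero, add_zero]
    intro j hj
    rcases (hA i j).eq_or_lt with h | h
    · rw [← h, zero_mul]
    · rw [hout i hi j (Finset.mem_compl.1 hj) h, mul_zero]
  have hle : ∀ i, (A *ᵥ u) i ≤ t * u i := by
    intro i
    by_cases hiν : i ∈ ν
    · exact (hon i hiν).le
    by_cases hi : Access A i j₀
    · rw [hsplit i hi]
      have h1 : M * ∑ j ∈ (cl i)ᶜ, A i j * u j ≤ M ^ accessCard A i * ∑ j, A i j * X j := by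
        rw [Finset.mul_sum, Finset.mul_sum]
        refine le_trans (Finset.sum_le_sum fun j hj => ?_)
          (Finset.sum_le_sum_of_subset_of_nonneg (Finset.subset_univ (cl i)ᶜ) fun j _ _ =>
            mul_nonneg (pow_pos hM0 _).le (mul_nonneg (hA i j) (hXpos j).le))
        rcases (hA i j).eq_or_lt with h | h
        · simp [← h]
        have hcard : accessCard A j + 1 ≤ accessCard A i :=
          accessCard_lt (.single h) fun hji => Finset.mem_compl.1 hj
            ((mem_class_iff (hcl i) (hmem i) j).2 ⟨.single h, hji⟩)
        have hpow : M * M ^ accessCard A j ≤ M ^ accessCard A i := by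
          rw [← pow_succ']
          exact pow_le_pow_right₀ hM1 hcard
        have huj : u j ≤ M ^ accessCard A j * X j := by
          simp only [hu]
          split_ifs
          · exact le_rfl
          · exact (mul_pos (pow_pos hM0 _) (hXpos j)).le
        calc M * (A i j * u j) ≤ M * (A i j * (M ^ accessCard A j * X j)) := by gcongr
          _ = M * M ^ accessCard A j * (A i j * X j) := by ring
          _ ≤ _ := mul_le_mul_of_nonneg_right hpow (mul_nonneg h.le (hXpos j).le)
      have h2 := mul_le_mul_of_nonneg_left (hMi i hi hiν) (pow_pos hM0 (accessCard A i)).le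
      have hui : u i = M ^ accessCard A i * X i := by
        simp only [hu]
        rw [if_pos hi]
      have h3 : M * ∑ j ∈ (cl i)ᶜ, A i j * u j ≤ M * ((t - classRoot A (cl i)) * u i) := by
        rw [hui]
        linarith
      have := le_of_mul_le_mul_left h3 hM0
      linarith
    · have hui : u i = 0 := by
        simp only [hu]
        rw [if_neg hi]
      rw [hui, mul_zero]
      refine le_of_eq (Finset.sum_eq_zero fun j _ => ?_)
      rcases (hA i j).eq_or_lt with h | h
      · simp only [← h, zero_mul]
      · simp only [hu]
        rw [if_neg fun hj => hi (Access.trans (.single h) hj), mul_zero]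
  have huj₀ : 0 < u j₀ := by
    simp only [hu]
    rw [if_pos (.refl j₀)]
    exact mul_pos (pow_pos hM0 _) (hXpos j₀)
  refine ⟨ht0, ?_⟩
  -- For t = 0 the iteration of t⁻¹A is unavailable, but then 0 ≤ Au ≤ 0 already.
  rcases ht0.eq_or_lt with h0 | h0
  · refine ⟨u, fun h => huj₀.ne' (congrFun h j₀), hu0, funext fun i => ?_⟩
    refine le_antisymm (hle i) ?_
    rw [Pi.smul_apply, ← h0, zero_smul]
    exact mulVec_nonneg hA hu0 i
  · obtain ⟨w, hw0, hwν, hAw⟩ := exists_eigenvector_of_mulVec_le hA hu0 h0 hle hon hout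
    exact ⟨w, fun h => huj₀.ne' (by rw [← hwν j₀ hj₀, h, Pi.zero_apply]), hw0, hAw⟩

/-! ### Sums, polynomials and matrices commuting with the family -/

/-- On a common class of commuting nonnegative matrices, the Perron root of their sum is the sum
of their Perron roots. -/
theorem classRoot_sum {ι κ : Type*} [Fintype ι] [Fintype κ] {A : κ → Matrix ι ι ℝ}
    (hA : ∀ k i j, 0 ≤ A k i j) (hcomm : ∀ k l, A k * A l = A l * A k)
    (hacc : ∀ k i j, Access (A k) i j ↔ Access (∑ l, A l) i j) {σ : Finset ι}
    (hσ : σ ∈ classes (∑ l, A l)) : classRoot (∑ l, A l) σ = ∑ k, classRoot (A k) σ := by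
  obtain ⟨w, hw0, -, hne, t, ht⟩ := exists_common_class_vector hA hcomm
    (fun k i j h => (hacc k i j).1 (.single h)) hσ
  have hroot : ∀ k, classRoot (A k) σ = t k := fun k =>
    classRoot_eq (hA k) (by rwa [classes_congr (hacc k)]) hne (fun i _ => hw0 i) (ht k)
  rw [Finset.sum_congr rfl fun k _ => hroot k]
  refine classRoot_eq (fun i j => ?_) hσ hne (fun i _ => hw0 i) fun i hi => ?_
  · rw [Matrix.sum_apply]
    exact Finset.sum_nonneg fun k _ => hA k i j
  · simp only [Matrix.sum_apply, Finset.sum_mul]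
    rw [Finset.sum_comm]
    exact Finset.sum_congr rfl fun k _ => ht k i hi

theorem commute_polyEval {ι : Type*} [Fintype ι] [DecidableEq ι] {r : ℕ}
    {A : Fin r → Matrix ι ι ℝ} (hcomm : ∀ k l, A k * A l = A l * A k)
    (p : MvPolynomial (Fin r) ℝ) (l : Fin r) : Commute (A l) (polyEval p A) := by
  refine Commute.sum_right _ _ _ fun m _ => Commute.smul_right ?_ _
  refine Commute.list_prod_right _ _ fun B hB => ?_
  obtain ⟨k, rfl⟩ := (List.mem_ofFn' _ _).1 hB
  exact Commute.pow_right (hcomm l k) _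

theorem pow_mulVec_eq {ι : Type*} [Fintype ι] [DecidableEq ι] {B : Matrix ι ι ℝ} {w : ι → ℝ}
    {t : ℝ} (h : B *ᵥ w = t • w) (m : ℕ) : (B ^ m) *ᵥ w = t ^ m • w := by
  induction m with
  | zero => simp
  | succ m ih => rw [pow_succ, ← mulVec_mulVec, h, mulVec_smul, ih, smul_smul, pow_succ']

theorem prod_ofFn_mulVec {ι : Type*} [Fintype ι] [DecidableEq ι] {r : ℕ}
    {B : Fin r → Matrix ι ι ℝ} {w : ι → ℝ} {t : Fin r → ℝ} (h : ∀ k, B k *ᵥ w = t k • w) :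
    (List.ofFn B).prod *ᵥ w = (∏ k, t k) • w := by
  induction r with
  | zero => simp
  | succ r ih =>
    rw [List.ofFn_succ, List.prod_cons, ← mulVec_mulVec, ih fun k => h k.succ, mulVec_smul, h 0,
      smul_smul, Fin.prod_univ_succ, mul_comm]

theorem polyEval_mulVec {ι : Type*} [Fintype ι] [DecidableEq ι] {r : ℕ}
    {A : Fin r → Matrix ι ι ℝ} {w : ι → ℝ} {t : Fin r → ℝ} (h : ∀ k, A k *ᵥ w = t k • w)
    (p : MvPolynomial (Fin r) ℝ) : polyEval p A *ᵥ w = MvPolynomial.eval t p • w := by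
  rw [polyEval, sum_mulVec, MvPolynomial.eval_eq', Finset.sum_smul]
  refine Finset.sum_congr rfl fun m _ => ?_
  rw [smul_mulVec, prod_ofFn_mulVec fun k => pow_mulVec_eq (h k) (m k), smul_smul]

/-- A distinguished eigenvalue of a matrix commuting with the family `A` has a nonnegative
eigenvector on which the family acts by the Perron roots of a common premier spectral class. -/
theorem exists_premier_of_distinguished {ι κ : Type*} [Fintype ι] [Finite κ] {S : Matrix ι ι ℝ}
    {A : κ → Matrix ι ι ℝ} (hA : ∀ k i j, 0 ≤ A k i j) (hcomm : ∀ k l, A k * A l = A l * A k)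
    (hinj : ∀ k, Set.InjOn (classRoot (A k)) (classes (A k)))
    (hacc : ∀ k i j, Access (A k) i j ↔ Access S i j) {P : Matrix ι ι ℝ}
    (hP : ∀ k, A k * P = P * A k) {t : ℝ} (ht : t ∈ distinguishedSpectrum P) :
    ∃ ν, (∀ k, IsPremierSpectralClass (A k) ν) ∧ ∃ w : ι → ℝ, w ≠ 0 ∧ (∀ i, 0 ≤ w i) ∧
      P *ᵥ w = t • w ∧ ∀ k, A k *ᵥ w = classRoot (A k) ν • w := by
  obtain ⟨-, v, hvne, hv0, hv⟩ := ht
  have hmem : ∀ x, x ∈ LinearMap.ker (P.mulVecLin - t • LinearMap.id) ↔ P *ᵥ x = t • x := by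
    intro x
    simp [sub_eq_zero]
  obtain ⟨w, hw, hne, hw0, s, hs⟩ := exists_common_eigenvector_mem hA hcomm
    (V := LinearMap.ker (P.mulVecLin - t • LinearMap.id))
    (fun k x hx => by
      rw [hmem] at hx ⊢
      rw [mulVec_mulVec, ← hP, ← mulVec_mulVec, hx, mulVec_smul])
    ⟨v, (hmem v).2 hv, hvne, hv0⟩
  obtain ⟨ν, hν⟩ := exists_premier_of_common_eigenvector hA hinj hacc hne hw0 fun k => (hs k).2
  exact ⟨ν, fun k => (hν k).2, w, hne, hw0, (hmem w).1 hw, fun k => by rw [(hν k).1, (hs k).2]⟩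

end NonnegMatrix

/-! ### The four assertions -/

open NonnegMatrix in
theorem theoremt (n r : ℕ) (hr : 0 < r) (A : Fin r → Matrix (Fin n) (Fin n) ℝ)
    (hnonneg : ∀ k i j, 0 ≤ A k i j)
    (hcomm : ∀ k l, A k * A l = A l * A k)
    (hdistinct : ∀ k, Set.InjOn (NonnegMatrix.classRoot (A k)) (NonnegMatrix.classes (A k))) :
    (∀ k, NonnegMatrix.classes (A k) = NonnegMatrix.classes (∑ l, A l)) ∧
    (∀ k μ ν, NonnegMatrix.ClassAccess (A k) μ ν ↔ NonnegMatrix.ClassAccess (∑ l, A l) μ ν) ∧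
    ((∀ k l μ, NonnegMatrix.IsPremierSpectralClass (A k) μ ↔
        NonnegMatrix.IsPremierSpectralClass (A l) μ) ∧
      (∀ k μ, NonnegMatrix.IsPremierSpectralClass (A k) μ →
        NonnegMatrix.IsPremierSpectralClass (∑ l, A l) μ) ∧
      (∀ k, (NonnegMatrix.distinguishedSpectrum (A k)).Finite) ∧
      (∀ k l, (NonnegMatrix.distinguishedSpectrum (A k)).ncard =
        (NonnegMatrix.distinguishedSpectrum (A l)).ncard)) ∧
    (∀ p : MvPolynomial (Fin r) ℝ, (∀ i j, 0 ≤ NonnegMatrix.polyEval p A i j) →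
      NonnegMatrix.distinguishedSpectrum (NonnegMatrix.polyEval p A) =
        {t | ∃ μ, (∀ k, NonnegMatrix.IsPremierSpectralClass (A k) μ) ∧
          t = MvPolynomial.eval (fun k => NonnegMatrix.classRoot (A k) μ) p}) := by
  have hacc : ∀ k i j, Access (A k) i j ↔ Access (∑ l, A l) i j := by
    intro k
    refine access_iff_of_le (hnonneg k) (fun i j => ?_) ?_ (hdistinct k)
    · rw [Matrix.sum_apply]
      exact Finset.single_le_sum (f := fun l => A l i j) (fun l _ => hnonneg l i j)
        (Finset.mem_univ k)
    · rw [Finset.mul_sum, Finset.sum_mul]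
      exact Finset.sum_congr rfl fun l _ => hcomm k l
  have hdist : ∀ k μ, IsPremierSpectralClass (A k) μ →
      (∀ l, IsPremierSpectralClass (A l) μ) ∧ ∃ w : Fin n → ℝ, w ≠ 0 ∧ (∀ i, 0 ≤ w i) ∧
        ∀ l, A l *ᵥ w = classRoot (A l) μ • w := by
    intro k μ hμ
    obtain ⟨ν, hν, w, hne, hw0, hw, hAw⟩ := exists_premier_of_distinguished hnonneg hcomm
      hdistinct hacc (fun l => hcomm l k) (distinguished_of_premier (hnonneg k) hμ)
    -- The vector `w` has eigenvalue `classRoot (A k) μ` by choice and `classRoot (A k) ν` by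
    -- construction; distinct roots force the classes to agree.
    have : ν = μ := by
      refine hdistinct k (hν k).1.1 hμ.1.1 ?_
      rw [hAw k] at hw
      exact smul_left_injective ℝ hne hw
    subst this
    exact ⟨hν, w, hne, hw0, hAw⟩
  have hprem : ∀ k l μ, IsPremierSpectralClass (A k) μ ↔ IsPremierSpectralClass (A l) μ :=
    fun k l μ => ⟨fun h => (hdist k μ h).1 l, fun h => (hdist l μ h).1 k⟩
  have hspec : ∀ k, distinguishedSpectrum (A k) =
      classRoot (A k) '' {μ | IsPremierSpectralClass (A k) μ} := by
    intro k
    ext t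
    constructor
    · intro ht
      obtain ⟨ν, hν, w, hne, -, hw, hAw⟩ := exists_premier_of_distinguished hnonneg hcomm
        hdistinct hacc (fun l => hcomm l k) ht
      rw [hAw k] at hw
      exact ⟨ν, hν k, smul_left_injective ℝ hne hw⟩
    · rintro ⟨μ, hμ, rfl⟩
      exact distinguished_of_premier (hnonneg k) hμ
  refine ⟨fun k => classes_congr (hacc k), fun k => classAccess_congr (hacc k),
    ⟨hprem, fun k μ hμ => ?_, fun k => ?_, fun k l => ?_⟩, fun p hp => ?_⟩
  · have hcl : ∀ l, classes (A l) = classes (∑ l, A l) := fun l => classes_congr (hacc l)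
    refine (isPremierSpectralClass_iff fun i j => ?_).2 ⟨hcl k ▸ hμ.1.1, fun σ hσ hne => ?_⟩
    · rw [Matrix.sum_apply]
      exact Finset.sum_nonneg fun l _ => hnonneg l i j
    · rw [classRoot_sum hnonneg hcomm hacc hσ.1, classRoot_sum hnonneg hcomm hacc hσ.2.1]
      refine Finset.sum_lt_sum_of_nonempty ⟨k, Finset.mem_univ k⟩ fun l _ => ?_
      exact ((hprem k l μ).1 hμ).2 σ ((classAccess_congr (hacc l) σ μ).2 hσ) hne
  · rw [hspec]
    exact (Set.toFinite _).image _
  · have hinj : ∀ k, Set.InjOn (classRoot (A k)) {μ | IsPremierSpectralClass (A k) μ} :=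
      fun k => (hdistinct k).mono fun μ hμ => hμ.1.1
    rw [hspec, hspec, (hinj k).ncard_image, (hinj l).ncard_image]
    simp only [hprem k l]
  · ext t
    constructor
    · intro ht
      obtain ⟨ν, hν, w, hne, -, hw, hAw⟩ := exists_premier_of_distinguished hnonneg hcomm
        hdistinct hacc (commute_polyEval hcomm p) ht
      rw [polyEval_mulVec hAw] at hw
      exact ⟨ν, hν, (smul_left_injective ℝ hne hw).symm⟩
    · rintro ⟨μ, hμ, rfl⟩
      -- Some member of the family is needed to produce the common eigenvector, hence r ≥ 1.
      obtain ⟨-, w, hne, hw0, hAw⟩ := hdist ⟨0, hr⟩ μ (hμ _)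
      have hPw := polyEval_mulVec hAw p
      refine ⟨?_, w, hne, hw0, hPw⟩
      -- The value of p is nonnegative because p(A₁, …, A_r) is nonnegative and `w` has a positive
      -- coordinate.
      obtain ⟨i, hi⟩ := Function.ne_iff.mp hne
      have hwi : 0 < w i := lt_of_le_of_ne (hw0 i) (Ne.symm hi)
      have h1 := mulVec_nonneg hp hw0 i
      rw [hPw, Pi.smul_apply, smul_eq_mul] at h1
      exact nonneg_of_mul_nonneg_left h1 hwi
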